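/- A plane real-algebraic curve of degree $d$ is given by a squarefree polynomial $f\in\mathbb R[x,y]$ of total degree $d$. Its evolute $E_f$ is the locus of its centres of curvature, i.e. the closure in $\mathbb C^2$ of the set of points $$\Bigl(x+\frac{f_x\,(f_x^2+f_y^2)}{\kappa},\; y+\frac{f_y\,(f_x^2+f_y^2)}{\kappa}\Bigr),\qquad \kappa=2f_xf_yf_{xy}-f_y^2f_{xx}-f_x^2f_{yy},$$ where $(x,y)\in\mathbb C^2$ runs over the points with $f(x,y)=0$ and $\kappa(x,y)\neq 0$. A crunode of $E_f$ is a real node with two real branches, that is, a point $p\in\mathbb R^2$ near which $E_f$ is, in $\mathbb C^2$, the union of two smooth real branches meeting transversally at $p$. Let $\delta_E^{\mathrm{cru}}(d)$ be the maximal number (the supremum in $\mathbb N\cup\{\infty\}$) of crunodes of $E_f$ over all real-algebraic curves $f=0$ of degree $d$. **Proposition.** For every integer $d\ge 2$, $$\delta_E^{\mathrm{cru}}(d)\;\ge\;\binom{m}{2}=\frac{m(m-1)}{2},\qquad m=\Bigl\lfloor\frac{(d-2)^2}{2}\Bigr\rfloor+d-2 .$$ -/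

import Mathlib

open MvPolynomial Filter Topology

namespace PlaneEvolute

/-- A plane real-algebraic curve of degree `d`, given by its reduced real equation: a squarefree
real polynomial in two variables of total degree `d`. The curve may be reducible or singular. -/
def IsRealCurve (d : ℕ) (f : MvPolynomial (Fin 2) ℝ) : Prop :=
  Squarefree f ∧ f.totalDegree = d

/-- First partial derivative of `f` in the variable `i`, evaluated at a point of `ℂ²`. -/
noncomputable def d1 (f : MvPolynomial (Fin 2) ℝ) (i : Fin 2) (q : Fin 2 → ℂ) : ℂ :=
  aeval q (pderiv i f)

/-- Second partial derivative of `f` in the variables `i` and `j`, evaluated at a point of `ℂ²`. -/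
noncomputable def d2 (f : MvPolynomial (Fin 2) ℝ) (i j : Fin 2) (q : Fin 2 → ℂ) : ℂ :=
  aeval q (pderiv i (pderiv j f))

/-- `2 f_x f_y f_xy - f_y² f_xx - f_x² f_yy` at `q`. At a point `q` of the curve `f = 0` it is
nonzero exactly when `q` is a nonsingular point that is not an inflection point. -/
noncomputable def curvatureForm (f : MvPolynomial (Fin 2) ℝ) (q : Fin 2 → ℂ) : ℂ :=
  2 * d1 f 0 q * d1 f 1 q * d2 f 0 1 q - d1 f 1 q ^ 2 * d2 f 0 0 q - d1 f 0 q ^ 2 * d2 f 1 1 q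

/-- The centre of curvature of the curve `f = 0` at its point `q`
(meaningful when `curvatureForm f q ≠ 0`). -/
noncomputable def curvatureCenter (f : MvPolynomial (Fin 2) ℝ) (q : Fin 2 → ℂ) : Fin 2 → ℂ :=
  fun i => q i + d1 f i q * (d1 f 0 q ^ 2 + d1 f 1 q ^ 2) / curvatureForm f q

/-- The set of complex points of the evolute of the curve `f = 0`: the closure in `ℂ²` of the set
of all centres of curvature. (That set is constructible, so its closure in the usual topology is
its Zariski closure, the zero set obtained by elimination.) -/
def evolute (f : MvPolynomial (Fin 2) ℝ) : Set (Fin 2 → ℂ) :=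
  closure {c | ∃ q : Fin 2 → ℂ, aeval q f = 0 ∧ curvatureForm f q ≠ 0 ∧ c = curvatureCenter f q}

/-- The inclusion `ℝ² ⊆ ℂ²`. -/
def toComplex (p : Fin 2 → ℝ) : Fin 2 → ℂ := fun i => (p i : ℂ)

/-- `h = 0` is the equation of a smooth real branch at the real point `p`: `h` is holomorphic
near `p`, takes real values at real points, vanishes at `p`, and `dh(p) ≠ 0`. -/
def IsSmoothRealBranch (h : (Fin 2 → ℂ) → ℂ) (p : Fin 2 → ℝ) : Prop :=
  AnalyticAt ℂ h (toComplex p) ∧ (∀ᶠ x in 𝓝 p, (h (toComplex x)).im = 0) ∧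
    h (toComplex p) = 0 ∧ fderiv ℂ h (toComplex p) ≠ 0

/-- The real point `p` is a crunode of the complex plane curve with point set `C`: it is a node
both of whose branches are real, that is, near `p` in `ℂ²` the curve is the union of two smooth
real branches which meet transversally at `p`. -/
def IsCrunode (C : Set (Fin 2 → ℂ)) (p : Fin 2 → ℝ) : Prop :=
  ∃ h₁ h₂ : (Fin 2 → ℂ) → ℂ, IsSmoothRealBranch h₁ p ∧ IsSmoothRealBranch h₂ p ∧
    LinearIndependent ℂ ![fderiv ℂ h₁ (toComplex p), fderiv ℂ h₂ (toComplex p)] ∧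
    ∀ᶠ z in 𝓝 (toComplex p), z ∈ C ↔ h₁ z = 0 ∨ h₂ z = 0

/-- The number of crunodes in `ℝ²` of the evolute of the curve `f = 0`. -/
noncomputable def evoluteCrunodes (f : MvPolynomial (Fin 2) ℝ) : ℕ∞ :=
  {p : Fin 2 → ℝ | IsCrunode (evolute f) p}.encard

/-- The maximal number of crunodes of the evolute, over all real-algebraic curves of degree `d`
(a supremum in `ℕ ∪ {∞}`). -/
noncomputable def maxEvoluteCrunodes (d : ℕ) : ℕ∞ :=
  ⨆ f : {f : MvPolynomial (Fin 2) ℝ // IsRealCurve d f}, evoluteCrunodes f.1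

end PlaneEvolute

/-! Take `d` real lines in general position with product `f` and smooth them to the curve `f = t ^
3` for small `t > 0`. Away from the nodes this curve is nearly straight and its centres of curvature
escape to infinity. Near a node it bends from one line to the other, and the centres that stay
bounded, and away from the node, accumulate on the two normals to the lines at that node. The normal
to line `i` at its node with `j` and the normal to line `k` at its node with `l`, where `i ≠ k` and
`j, l ∉ {i, k}`, cross transversally at a point that lies on no other such normal. Each of these
`d.choose 2 * (d - 2) ^ 2` crossings persists as a crunode, and there are at least as many of them
as the bound asks for.

Near a node let `u`, `v` be the two line equations and `G` the product of the others. In the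
weighted coordinates `u = t ^ 2 * w`, `v = t * s` the curve becomes `s * w * G = 1`, and the centre
of curvature extends analytically to `t = 0`, where it runs along the normal with parameter
proportional to `s ^ 2 / w` (`blowCenter_zero_one`). The inverse function theorem turns this into an
analytic family of graphs tending to the normal (`exists_branch`). A point of the normal determines
only `s ^ 3`, so three complex branches tend to it, one of them real. They separate at first order:
the deviation from the normal is a nonzero real multiple of `s * t` (`exists_tendsto_blow`), so the
branches with non-real `s` stay at distance of order `t` from `ℝ²`. Within `t ^ 2` of a real point
only the real branch is visible, which suffices because being a crunode is a local condition.

It remains to see that no other centres come near a crossing. This is a compactness argument along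
ultrafilters: points with convergent centres are bounded (`exists_norm_le_of_tendsto_center`), tend
to a node (`exists_lineVal_eq_zero_of_tendsto`), and have their centres tend to the node or to a
point of one of its normals (`normalForm_eq_zero_of_tendsto`).
`GeneralPosition.eventually_center_mem` combines these, and the intermediate value theorem supplies
the crossing of the two real branches. -/

namespace PlaneEvolute

/-! ### Curvature of products containing line equations -/

/-- The equation `y - a x - b` of the line of slope `a` and intercept `b`. -/
noncomputable def lineEq (a b : ℝ) : MvPolynomial (Fin 2) ℝ := X 1 - C a * X 0 - C b

/-- The value of `lineEq a b` at a point. -/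
def lineVal (a b : ℝ) (q : Fin 2 → ℂ) : ℂ := q 1 - a * q 0 - b

lemma aeval_lineEq (a b : ℝ) (q : Fin 2 → ℂ) : aeval q (lineEq a b) = lineVal a b q := by
  simp [lineEq, lineVal]

lemma pderiv_zero_lineEq (a b : ℝ) : pderiv 0 (lineEq a b) = -C a := by
  simp [lineEq, pderiv_X]

lemma pderiv_one_lineEq (a b : ℝ) : pderiv 1 (lineEq a b) = 1 := by
  simp [lineEq, pderiv_X]

lemma d1_mul (f g : MvPolynomial (Fin 2) ℝ) (i : Fin 2) (q : Fin 2 → ℂ) :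
    d1 (f * g) i q = d1 f i q * aeval q g + aeval q f * d1 g i q := by
  simp only [d1, Derivation.leibniz, smul_eq_mul, map_add, map_mul]
  ring

lemma d2_mul (f g : MvPolynomial (Fin 2) ℝ) (i j : Fin 2) (q : Fin 2 → ℂ) :
    d2 (f * g) i j q = d2 f i j q * aeval q g + d1 f i q * d1 g j q + d1 f j q * d1 g i q
      + aeval q f * d2 g i j q := by
  simp only [d1, d2, Derivation.leibniz, smul_eq_mul, map_add, map_mul]
  ring

lemma d1_lineEq_zero (a b : ℝ) (q : Fin 2 → ℂ) : d1 (lineEq a b) 0 q = -a := by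
  simp [d1, pderiv_zero_lineEq]

lemma d1_lineEq_one (a b : ℝ) (q : Fin 2 → ℂ) : d1 (lineEq a b) 1 q = 1 := by
  simp [d1, pderiv_one_lineEq]

lemma d2_lineEq (a b : ℝ) (i j : Fin 2) (q : Fin 2 → ℂ) : d2 (lineEq a b) i j q = 0 := by
  fin_cases j <;> simp [d2, pderiv_zero_lineEq, pderiv_one_lineEq]

/-- On a line component the curvature form of the whole curve vanishes. -/
lemma curvatureForm_lineEq_mul (a b : ℝ) (Q : MvPolynomial (Fin 2) ℝ) (q : Fin 2 → ℂ)
    (hq : lineVal a b q = 0) : curvatureForm (lineEq a b * Q) q = 0 := by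
  simp only [curvatureForm, d1_mul, d2_mul, d1_lineEq_zero, d1_lineEq_one, d2_lineEq,
    aeval_lineEq, hq]
  ring

/-- The quotient of the curvature form of `u v G` (with `u`, `v` the equations of two lines of
slopes `a`, `a'`) by `u v`, as a function of the values of `u`, `v` and the derivatives of `G`. -/
noncomputable def nodalForm (a a' u v g gx gy gxx gxy gyy : ℂ) : ℂ :=
  2 * (a - a') ^ 2 * g ^ 3
    - 2 * g ^ 2 * (2 * a * a' * ((u + v) * gy)
        + (a + a') * ((u + v) * gx - (a * v + a' * u) * gy)
        - 2 * ((a * v + a' * u) * gx))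
    - g * (u * v) * (2 * a * a' * gy ^ 2 + 2 * (a + a') * (gx * gy) + 2 * gx ^ 2)
    + 2 * g * (-(a * v + a' * u) * gy - (u + v) * gx) ^ 2
    - (gxx * (g * (u + v) + u * v * gy) ^ 2
      - 2 * gxy * (g * (u + v) + u * v * gy) * (-g * (a * v + a' * u) + u * v * gx)
      + gyy * (-g * (a * v + a' * u) + u * v * gx) ^ 2)

/-- `nodalForm` for the curve `lineEq a b * lineEq a' b' * G`, as a function of the point. -/
noncomputable def nodalFormAt (a b a' b' : ℝ) (G : MvPolynomial (Fin 2) ℝ) (q : Fin 2 → ℂ) : ℂ :=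
  nodalForm a a' (lineVal a b q) (lineVal a' b' q) (aeval q G) (d1 G 0 q) (d1 G 1 q)
    (d2 G 0 0 q) (d2 G 0 1 q) (d2 G 1 1 q)

/-- The form vanishes on both line components, so both equations divide it. The cofactor is nonzero
at a simple node (`nodalFormAt_node`), so near the node the form has the exact order of `u * v`. -/
lemma curvatureForm_node (a b a' b' : ℝ) (G : MvPolynomial (Fin 2) ℝ) (q : Fin 2 → ℂ) :
    curvatureForm (lineEq a b * lineEq a' b' * G) q =
      lineVal a b q * lineVal a' b' q * nodalFormAt a b a' b' G q := by
  simp only [curvatureForm, nodalFormAt, nodalForm, d1_mul, d2_mul, d1_lineEq_zero,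
    d1_lineEq_one, d2_lineEq, aeval_lineEq, map_mul]
  ring

lemma d1_node_zero (a b a' b' : ℝ) (G : MvPolynomial (Fin 2) ℝ) (q : Fin 2 → ℂ) :
    d1 (lineEq a b * lineEq a' b' * G) 0 q =
      -(a * lineVal a' b' q + a' * lineVal a b q) * aeval q G
        + lineVal a b q * lineVal a' b' q * d1 G 0 q := by
  simp only [d1_mul, d1_lineEq_zero, aeval_lineEq, map_mul]
  ring

lemma d1_node_one (a b a' b' : ℝ) (G : MvPolynomial (Fin 2) ℝ) (q : Fin 2 → ℂ) :
    d1 (lineEq a b * lineEq a' b' * G) 1 q =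
      (lineVal a' b' q + lineVal a b q) * aeval q G
        + lineVal a b q * lineVal a' b' q * d1 G 1 q := by
  simp only [d1_mul, d1_lineEq_one, aeval_lineEq, map_mul]
  ring

lemma d1_sub_C (f : MvPolynomial (Fin 2) ℝ) (e : ℝ) (i : Fin 2) : d1 (f - C e) i = d1 f i := by
  ext q; simp [d1]

lemma d2_sub_C (f : MvPolynomial (Fin 2) ℝ) (e : ℝ) (i j : Fin 2) :
    d2 (f - C e) i j = d2 f i j := by
  ext q; simp [d2]

lemma curvatureForm_sub_C (f : MvPolynomial (Fin 2) ℝ) (e : ℝ) :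
    curvatureForm (f - C e) = curvatureForm f := by
  ext q
  unfold curvatureForm
  rw [d1_sub_C, d1_sub_C, d2_sub_C, d2_sub_C, d2_sub_C]

lemma curvatureCenter_sub_C (f : MvPolynomial (Fin 2) ℝ) (e : ℝ) :
    curvatureCenter (f - C e) = curvatureCenter f := by
  ext q
  unfold curvatureCenter
  simp only [curvatureForm_sub_C, d1_sub_C]

lemma center_sub_mul (f : MvPolynomial (Fin 2) ℝ) (q : Fin 2 → ℂ) (hq : curvatureForm f q ≠ 0)
    (i : Fin 2) :
    (curvatureCenter f q i - q i) * curvatureForm f q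
      = d1 f i q * (d1 f 0 q ^ 2 + d1 f 1 q ^ 2) := by
  simp only [curvatureCenter]
  field_simp
  ring

/-- The centre of curvature lies on the normal. -/
lemma center_normal (f : MvPolynomial (Fin 2) ℝ) (q : Fin 2 → ℂ) :
    (curvatureCenter f q 0 - q 0) * d1 f 1 q - (curvatureCenter f q 1 - q 1) * d1 f 0 q = 0 := by
  simp only [curvatureCenter]
  ring

lemma continuous_aeval_real (f : MvPolynomial (Fin 2) ℝ) :
    Continuous fun q : Fin 2 → ℂ => aeval q f := by
  have h := (f.map (algebraMap ℝ ℂ)).continuous_eval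
  simp only [eval_map] at h
  exact h

@[fun_prop]
lemma continuous_d1 (f : MvPolynomial (Fin 2) ℝ) (i : Fin 2) : Continuous (d1 f i) :=
  continuous_aeval_real _

@[fun_prop]
lemma continuous_d2 (f : MvPolynomial (Fin 2) ℝ) (i j : Fin 2) : Continuous (d2 f i j) :=
  continuous_aeval_real _

@[fun_prop]
lemma continuous_lineVal (a b : ℝ) : Continuous (lineVal a b) := by
  unfold lineVal; fun_prop

lemma continuous_curvatureForm (f : MvPolynomial (Fin 2) ℝ) : Continuous (curvatureForm f) := by
  unfold curvatureForm; fun_prop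

lemma continuous_nodalFormAt (a b a' b' : ℝ) (G : MvPolynomial (Fin 2) ℝ) :
    Continuous (nodalFormAt a b a' b' G) := by
  have := continuous_aeval_real G
  unfold nodalFormAt nodalForm; fun_prop

lemma nodalFormAt_node (a b a' b' : ℝ) (G : MvPolynomial (Fin 2) ℝ) (q : Fin 2 → ℂ)
    (h : lineVal a b q = 0) (h' : lineVal a' b' q = 0) :
    nodalFormAt a b a' b' G q = 2 * (a - a') ^ 2 * aeval q G ^ 3 := by
  simp [nodalFormAt, nodalForm, h, h']

lemma aeval_conj (f : MvPolynomial (Fin 2) ℝ) (q : Fin 2 → ℂ) :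
    aeval (fun i => (starRingEnd ℂ) (q i)) f = (starRingEnd ℂ) (aeval q f) := by
  have h := MvPolynomial.comp_aeval_apply (f := q) (Complex.conjAe : ℂ →ₐ[ℝ] ℂ) f
  simpa using h.symm

/-! ### The smoothing: degree and squarefreeness -/

/-- The product of the equations of `d` lines. -/
noncomputable def lineArrangement {d : ℕ} (a b : Fin d → ℝ) : MvPolynomial (Fin 2) ℝ :=
  ∏ i, lineEq (a i) (b i)

/-- A one-parameter smoothing of a line arrangement. -/
noncomputable def smoothing {d : ℕ} (a b : Fin d → ℝ) (t : ℝ) : MvPolynomial (Fin 2) ℝ :=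
  lineArrangement a b - C (t ^ 3)

/-- The restriction of a polynomial to the line `x = 0`. -/
noncomputable def restrictAxis : MvPolynomial (Fin 2) ℝ →ₐ[ℝ] Polynomial ℝ :=
  aeval ![0, Polynomial.X]

lemma restrictAxis_lineEq (a b : ℝ) :
    restrictAxis (lineEq a b) = Polynomial.X - Polynomial.C b := by
  simp [restrictAxis, lineEq]

lemma natDegree_restrictAxis_le (f : MvPolynomial (Fin 2) ℝ) :
    (restrictAxis f).natDegree ≤ f.totalDegree := by
  have h := MvPolynomial.aeval_natDegree_le f (m := f.totalDegree) (n := 1) le_rfl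
    ![(0 : Polynomial ℝ), Polynomial.X] (by
      intro i; fin_cases i <;> simp)
  simpa [restrictAxis] using h

/-- If restriction to the axis does not lower the degree of a product, it lowers the degree of no
factor. A repeated factor restricts to a unit, hence has degree zero itself. -/
lemma squarefree_of_restrictAxis {f : MvPolynomial (Fin 2) ℝ}
    (hdeg : f.totalDegree ≤ (restrictAxis f).natDegree) (hs : Squarefree (restrictAxis f)) :
    Squarefree f := by
  intro g hg
  obtain ⟨h, rfl⟩ := hg
  have hne : g * g * h ≠ 0 := by
    intro h0
    rw [h0, map_zero] at hs
    exact not_squarefree_zero hs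
  have hg0 : g ≠ 0 := by rintro rfl; simp at hne
  have hh0 : h ≠ 0 := by rintro rfl; simp at hne
  rw [totalDegree_mul_of_isDomain (mul_ne_zero hg0 hg0) hh0,
    totalDegree_mul_of_isDomain hg0 hg0] at hdeg
  rw [map_mul, map_mul] at hdeg hs
  have hu : IsUnit (restrictAxis g) := hs _ (Dvd.intro _ rfl)
  have h1 : (restrictAxis g * restrictAxis g * restrictAxis h).natDegree
      ≤ (restrictAxis h).natDegree := by
    have := Polynomial.natDegree_eq_zero_of_isUnit hu
    refine Polynomial.natDegree_mul_le.trans ?_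
    have := Polynomial.natDegree_mul_le (p := restrictAxis g) (q := restrictAxis g)
    omega
  have h2 := natDegree_restrictAxis_le h
  have h3 : g.totalDegree = 0 := by omega
  rw [totalDegree_eq_zero_iff_eq_C] at h3
  rw [h3]
  refine (IsUnit.mk0 _ ?_).map C
  intro h0
  rw [h0, map_zero] at h3
  exact hg0 h3

/-- All but finitely many members of the pencil `p - e` are squarefree. -/
lemma finite_not_squarefree_sub_C (p : Polynomial ℝ) (hp : 0 < p.natDegree) :
    {e : ℝ | ¬ Squarefree (p - Polynomial.C e)}.Finite := by
  have hd : p.derivative.map (algebraMap ℝ ℂ) ≠ 0 := by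
    rw [Polynomial.map_ne_zero_iff (algebraMap ℝ ℂ).injective]
    intro h
    rw [Polynomial.derivative_eq_zero] at h
    omega
  -- A member with a multiple root `z` has `e = p(z)` with `z` a complex critical point of `p`. As
  -- `e` is real, it is the real part of one of finitely many critical values.
  refine Set.Finite.subset ((p.derivative.map (algebraMap ℝ ℂ)).roots.toFinset.image
      fun z => (Polynomial.aeval z p).re : Finset ℝ).finite_toSet ?_
  intro e he
  by_contra hne
  refine he (Polynomial.Separable.squarefree ?_)
  rw [← Polynomial.separable_map (algebraMap ℝ ℂ), Polynomial.Separable,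
    Polynomial.isCoprime_iff_aeval_ne_zero_of_isAlgClosed ℂ ℂ]
  intro z
  by_contra hz
  push Not at hz
  apply hne
  simp only [Finset.coe_image, Set.mem_image, Finset.mem_coe, Multiset.mem_toFinset]
  refine ⟨z, ?_, ?_⟩
  · rw [Polynomial.mem_roots hd]
    have := hz.2
    simpa [Polynomial.derivative_map, Polynomial.IsRoot] using this
  · have := hz.1
    simp [sub_eq_zero] at this
    simp [this]

lemma totalDegree_lineEq_le (a b : ℝ) : (lineEq a b).totalDegree ≤ 1 := by
  unfold lineEq
  refine (totalDegree_sub_C_le _ _).trans ((totalDegree_sub _ _).trans ?_)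
  refine max_le (by simp) ((totalDegree_mul _ _).trans (by simp))

lemma totalDegree_lineArrangement_le {d : ℕ} (a b : Fin d → ℝ) :
    (lineArrangement a b).totalDegree ≤ d := by
  refine (totalDegree_finsetProd _ _).trans ?_
  refine (Finset.sum_le_sum fun i _ => totalDegree_lineEq_le (a i) (b i)).trans ?_
  simp

lemma isRealCurve_smoothing {d : ℕ} (hd : 0 < d) (a b : Fin d → ℝ) :
    ∀ᶠ t in 𝓝[>] (0 : ℝ), IsRealCurve d (smoothing a b t) := by
  set p : Polynomial ℝ := ∏ i, (Polynomial.X - Polynomial.C (b i)) with hp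
  have hpd : p.natDegree = d := by
    rw [hp, Polynomial.natDegree_prod_of_monic _ _ fun i _ => Polynomial.monic_X_sub_C _]
    simp
  have hr : ∀ t, restrictAxis (smoothing a b t) = p - Polynomial.C (t ^ 3) := by
    intro t
    simp only [smoothing, lineArrangement, map_sub, map_prod, restrictAxis_lineEq, hp]
    congr 1
    simp [restrictAxis]
  have hfin := finite_not_squarefree_sub_C p (hpd ▸ hd)
  have hfin' : {t : ℝ | ¬ Squarefree (p - Polynomial.C (t ^ 3))}.Finite :=
    hfin.preimage ((Odd.strictMono_pow (by decide : Odd 3)).injective.injOn)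
  have hev : ∀ᶠ t in 𝓝[>] (0 : ℝ), Squarefree (p - Polynomial.C (t ^ 3)) := by
    have h1 : ∀ᶠ t in 𝓝[≠] (0 : ℝ), t ∉ {t : ℝ | ¬ Squarefree (p - Polynomial.C (t ^ 3))} := by
      have h0 := (hfin'.subset (Set.sdiff_subset (t := {0}))).isClosed.isOpen_compl.mem_nhds
        (x := (0 : ℝ)) (by simp)
      rw [eventually_nhdsWithin_iff]
      filter_upwards [h0] with t ht ht0 h
      exact ht ⟨h, ht0⟩
    have h2 := h1.filter_mono (nhdsWithin_mono 0 (fun x (hx : 0 < x) => hx.ne'))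
    filter_upwards [h2] with t ht
    simpa using ht
  filter_upwards [hev] with t ht
  have hdeg : (restrictAxis (smoothing a b t)).natDegree = d := by
    rw [hr, Polynomial.natDegree_sub_C, hpd]
  have hle : (smoothing a b t).totalDegree ≤ d :=
    (totalDegree_sub_C_le _ _).trans (totalDegree_lineArrangement_le a b)
  refine ⟨squarefree_of_restrictAxis (by omega) (by rwa [hr]), le_antisymm hle ?_⟩
  have := natDegree_restrictAxis_le (smoothing a b t)
  omega

/-! ### Nodes, normals and general position -/

/-- The abscissa of the common point of the lines `y = a x + b` and `y = a' x + b'`. -/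
noncomputable def nodeX (a b a' b' : ℝ) : ℝ := (b' - b) / (a - a')

/-- The common point of the lines `y = a x + b` and `y = a' x + b'`. -/
noncomputable def node (a b a' b' : ℝ) : Fin 2 → ℝ :=
  ![nodeX a b a' b', a * nodeX a b a' b' + b]

/-- The normal to the line `y = a x + b` at its common point with `y = a' x + b'` has the equation
`x + a y = normalConst a b a' b'`. -/
noncomputable def normalConst (a b a' b' : ℝ) : ℝ :=
  nodeX a b a' b' + a * (a * nodeX a b a' b' + b)

/-- The common point of the lines `x + a y = c` and `x + a' y = c'`. -/
noncomputable def normalsMeet (a c a' c' : ℝ) : Fin 2 → ℝ :=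
  ![c - a * ((c' - c) / (a' - a)), (c' - c) / (a' - a)]

lemma normalsMeet_left (a c a' c' : ℝ) :
    normalsMeet a c a' c' 0 + a * normalsMeet a c a' c' 1 = c := by
  simp [normalsMeet]

lemma normalsMeet_right {a a' : ℝ} (c c' : ℝ) (h : a ≠ a') :
    normalsMeet a c a' c' 0 + a' * normalsMeet a c a' c' 1 = c' := by
  have : a' - a ≠ 0 := sub_ne_zero.2 h.symm
  simp [normalsMeet]
  field_simp
  ring

/-- A choice of lines with sufficiently general position of the nodes and of the normals at the
nodes. -/
structure GeneralPosition {d : ℕ} (a b : Fin d → ℝ) : Prop where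
  slope_injective : Function.Injective a
  node_ne : ∀ i j j', j ≠ i → j' ≠ i → j ≠ j' →
    nodeX (a i) (b i) (a j) (b j) ≠ nodeX (a i) (b i) (a j') (b j')
  normal_ne : ∀ i k j l r s, i ≠ k → j ≠ i → j ≠ k → l ≠ i → l ≠ k → r ≠ i → r ≠ k → s ≠ r →
    (a k - a i) * (normalConst (a r) (b r) (a s) (b s) - normalConst (a i) (b i) (a j) (b j)) ≠
      (a r - a i) * (normalConst (a k) (b k) (a l) (b l) - normalConst (a i) (b i) (a j) (b j))

/-- `nodeX` as a linear functional of the intercepts. -/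
noncomputable def nodeXDual {d : ℕ} (a : Fin d → ℝ) (i j : Fin d) : Module.Dual ℝ (Fin d → ℝ) :=
  (a i - a j)⁻¹ • ((LinearMap.proj j : (Fin d → ℝ) →ₗ[ℝ] ℝ) - LinearMap.proj i)

lemma nodeXDual_apply {d : ℕ} (a b : Fin d → ℝ) (i j : Fin d) :
    nodeXDual a i j b = nodeX (a i) (b i) (a j) (b j) := by
  simp [nodeXDual, nodeX]
  ring

/-- `normalConst` as a linear functional of the intercepts. -/
noncomputable def normalConstDual {d : ℕ} (a : Fin d → ℝ) (i j : Fin d) :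
    Module.Dual ℝ (Fin d → ℝ) :=
  nodeXDual a i j + a i • (a i • nodeXDual a i j + LinearMap.proj i)

lemma normalConstDual_apply {d : ℕ} (a b : Fin d → ℝ) (i j : Fin d) :
    normalConstDual a i j b = normalConst (a i) (b i) (a j) (b j) := by
  simp [normalConstDual, normalConst, nodeXDual_apply]
  ring

lemma normalConst_single_self {d : ℕ} (a : Fin d → ℝ) {i j : Fin d} (h : a i ≠ a j) (hij : j ≠ i) :
    normalConst (a i) (Pi.single (M := fun _ => ℝ) i 1 i) (a j) (Pi.single (M := fun _ => ℝ) i 1 j)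
      = -(1 + a i * a j) / (a i - a j) := by
  have : a i - a j ≠ 0 := sub_ne_zero.2 h
  simp [normalConst, nodeX, hij]
  field_simp
  ring

lemma normalConst_single_other {d : ℕ} (a : Fin d → ℝ) {i j k : Fin d} (hik : i ≠ k)
    (hjk : j ≠ k) :
    normalConst (a i) (Pi.single (M := fun _ => ℝ) k 1 i) (a j) (Pi.single (M := fun _ => ℝ) k 1 j)
      = 0 := by
  simp [normalConst, nodeX, hik, hjk]

/-- For fixed slopes every condition says that a linear functional of the intercepts does not
vanish, and finitely many nonzero functionals have a common non-zero. The slopes `0, …, d - 1` are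
nonnegative, so no two lines are perpendicular; this is what makes the functionals of `normal_ne`
nonzero. -/
lemma exists_generalPosition (d : ℕ) : ∃ a b : Fin d → ℝ, GeneralPosition a b := by
  set a : Fin d → ℝ := fun i => (i : ℝ) with ha
  have hinj : Function.Injective a := fun i j h => by simpa [ha, Fin.ext_iff] using h
  have hpos : ∀ i j, 1 + a i * a j ≠ 0 := fun i j => by simp only [ha]; positivity
  let I₁ := {x : Fin d × Fin d × Fin d // x.2.1 ≠ x.1 ∧ x.2.2 ≠ x.1 ∧ x.2.1 ≠ x.2.2}
  let I₂ := {x : (Fin d × Fin d) × (Fin d × Fin d) × (Fin d × Fin d) //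
    x.1.1 ≠ x.1.2 ∧ x.2.1.1 ≠ x.1.1 ∧ x.2.1.1 ≠ x.1.2 ∧ x.2.1.2 ≠ x.1.1 ∧ x.2.1.2 ≠ x.1.2 ∧
      x.2.2.1 ≠ x.1.1 ∧ x.2.2.1 ≠ x.1.2 ∧ x.2.2.2 ≠ x.2.2.1}
  let F : I₁ ⊕ I₂ → Module.Dual ℝ (Fin d → ℝ) := Sum.elim
    (fun x => nodeXDual a x.1.1 x.1.2.1 - nodeXDual a x.1.1 x.1.2.2)
    (fun x => (a x.1.1.2 - a x.1.1.1) •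
        (normalConstDual a x.1.2.2.1 x.1.2.2.2 - normalConstDual a x.1.1.1 x.1.2.1.1)
      - (a x.1.2.2.1 - a x.1.1.1) •
        (normalConstDual a x.1.1.2 x.1.2.1.2 - normalConstDual a x.1.1.1 x.1.2.1.1))
  obtain ⟨b, hb⟩ := Module.Dual.exists_forall_ne_zero_of_forall_exists F (by
    rintro (⟨⟨i, j, j'⟩, hj, hj', hjj⟩ |
      ⟨⟨⟨i, k⟩, ⟨j, l⟩, ⟨r, s⟩⟩, hik, hji, hjk, hli, hlk, hri, hrk, hsr⟩)
    · refine ⟨Pi.single j 1, ?_⟩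
      simp only at hj hj' hjj
      have h1 : a i - a j ≠ 0 := sub_ne_zero.2 fun h => hj (hinj h).symm
      simp [F, nodeXDual_apply, nodeX, hj.symm, hjj.symm, h1]
    · simp only at hik hji hjk hli hlk hri hrk hsr
      have hne : ∀ {x y}, x ≠ y → a x - a y ≠ 0 := fun h => sub_ne_zero.2 fun h' => h (hinj h')
      -- The functional is tested on the intercept vector of a single line that moves exactly one of
      -- the three normals: line `k` if `s = i`, otherwise line `i`.
      by_cases hsi : s = i
      · refine ⟨Pi.single k 1, ?_⟩
        simp only [F, Sum.elim_inr, LinearMap.sub_apply, LinearMap.smul_apply,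
          normalConstDual_apply, smul_eq_mul]
        rw [normalConst_single_other a hrk (hsi ▸ hik), normalConst_single_other a hik hjk,
          normalConst_single_self a (fun h => hlk (hinj h).symm) hlk]
        simp only [sub_zero, mul_zero, zero_sub, neg_ne_zero]
        exact mul_ne_zero (hne hri) (div_ne_zero (neg_ne_zero.2 (hpos _ _)) (hne hlk.symm))
      · refine ⟨Pi.single i 1, ?_⟩
        simp only [F, Sum.elim_inr, LinearMap.sub_apply, LinearMap.smul_apply,
          normalConstDual_apply, smul_eq_mul]
        rw [normalConst_single_other a hri hsi, normalConst_single_other a hik.symm hli,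
          normalConst_single_self a (fun h => hji (hinj h).symm) hji]
        have h3 := mul_ne_zero (hne hrk) (div_ne_zero (neg_ne_zero.2 (hpos i j)) (hne hji.symm))
        convert h3 using 1
        ring)
  refine ⟨a, b, hinj, ?_, ?_⟩
  · intro i j j' hj hj' hjj
    have := hb (Sum.inl ⟨(i, j, j'), hj, hj', hjj⟩)
    simp only [F, Sum.elim_inl, LinearMap.sub_apply, nodeXDual_apply] at this
    exact sub_ne_zero.1 this
  · intro i k j l r s h1 h2 h3 h4 h5 h6 h7 h8
    have := hb (Sum.inr ⟨((i, k), (j, l), (r, s)), h1, h2, h3, h4, h5, h6, h7, h8⟩)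
    simp only [F, Sum.elim_inr, LinearMap.sub_apply, LinearMap.smul_apply,
      normalConstDual_apply, smul_eq_mul] at this
    exact sub_ne_zero.1 this

section Normals

variable {d : ℕ} {a b : Fin d → ℝ}

lemma normalConst_eq (a b a' b' : ℝ) :
    normalConst a b a' b' = (1 + a ^ 2) * nodeX a b a' b' + a * b := by
  unfold normalConst; ring

lemma GeneralPosition.normalConst_ne (h : GeneralPosition a b) {i j j' : Fin d} (hj : j ≠ i)
    (hj' : j' ≠ i) (hjj : j ≠ j') :
    normalConst (a i) (b i) (a j) (b j) ≠ normalConst (a i) (b i) (a j') (b j') := by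
  have := h.node_ne i j j' hj hj' hjj
  intro he
  rw [normalConst_eq, normalConst_eq] at he
  have h2 : (1 + a i ^ 2) ≠ 0 := by positivity
  exact this (mul_left_cancel₀ h2 (add_right_cancel he))

/-- Only the two given normals pass through their common point. -/
lemma GeneralPosition.eq_of_mem_normal (h : GeneralPosition a b) {i k j l : Fin d} (hik : i ≠ k)
    (hji : j ≠ i) (hjk : j ≠ k) (hli : l ≠ i) (hlk : l ≠ k) {p : Fin 2 → ℝ}
    (hp₁ : p 0 + a i * p 1 = normalConst (a i) (b i) (a j) (b j))
    (hp₂ : p 0 + a k * p 1 = normalConst (a k) (b k) (a l) (b l)) {r s : Fin d} (hsr : s ≠ r)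
    (hp : p 0 + a r * p 1 = normalConst (a r) (b r) (a s) (b s)) :
    (r = i ∧ s = j) ∨ (r = k ∧ s = l) := by
  by_cases hri : r = i
  · subst hri
    left
    refine ⟨rfl, ?_⟩
    by_contra hs
    exact h.normalConst_ne hsr hji hs (hp.symm.trans hp₁)
  by_cases hrk : r = k
  · subst hrk
    right
    refine ⟨rfl, ?_⟩
    by_contra hs
    exact h.normalConst_ne hsr hlk hs (hp.symm.trans hp₂)
  exfalso
  -- The equality excluded by `normal_ne` is the condition for the three normals to be concurrent.
  refine h.normal_ne i k j l r s hik hji hjk hli hlk hri hrk hsr ?_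
  rw [← hp₁, ← hp₂, ← hp]
  ring

end Normals

/-! ### Rescaling at a node and the analytic branches -/

/-- The analytic inverse function theorem in finite dimension. -/
lemma exists_analytic_inverse {E : Type*} [NormedAddCommGroup E] [NormedSpace ℂ E]
    [FiniteDimensional ℂ E] {f : E → E} {x₀ : E} (hf : AnalyticAt ℂ f x₀)
    (hinj : ∀ v, fderiv ℂ f x₀ v = 0 → v = 0) :
    ∃ g : E → E, AnalyticAt ℂ g (f x₀) ∧ g (f x₀) = x₀ ∧ (∀ᶠ x in 𝓝 x₀, g (f x) = x) ∧
      ∀ᶠ y in 𝓝 (f x₀), f (g y) = y := by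
  have : CompleteSpace E := FiniteDimensional.complete ℂ E
  let e : E ≃L[ℂ] E := (LinearEquiv.ofInjectiveEndo (fderiv ℂ f x₀ : E →ₗ[ℂ] E)
    (LinearMap.ker_eq_bot.1 (LinearMap.ker_eq_bot'.2 hinj))).toContinuousLinearEquiv
  have he : (e : E →L[ℂ] E) = fderiv ℂ f x₀ := by ext v; rfl
  have hd : HasFDerivAt f (e : E →L[ℂ] E) x₀ := by
    rw [he]; exact hf.differentiableAt.hasFDerivAt
  have hc : ContDiffAt ℂ (⊤ : WithTop ℕ∞) f x₀ := hf.contDiffAt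
  have hs := hc.hasStrictFDerivAt' hd (by simp)
  refine ⟨hc.localInverse hd (by simp), ?_, hc.localInverse_apply_image hd (by simp), ?_, ?_⟩
  · exact (hc.to_localInverse hd (by simp)).analyticAt
  · exact hs.eventually_left_inverse
  · exact hs.eventually_right_inverse

section Branch

variable (a b a' b' : ℝ) (G : MvPolynomial (Fin 2) ℝ)

/-- Rescaled coordinates `(w, s, t)` near a node, in which the two line equations are `t² w` and
`t s`. -/
noncomputable def blowPoint (x : ℂ × ℂ × ℂ) : Fin 2 → ℂ :=
  ![nodeX a b a' b' + (x.2.2 * x.2.1 - x.2.2 ^ 2 * x.1) / (a - a'),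
    a * nodeX a b a' b' + b + (a * (x.2.2 * x.2.1) - a' * (x.2.2 ^ 2 * x.1)) / (a - a')]

/-- The gradient divided by `t` in the coordinates `(w, s, t)`. -/
noncomputable def blowGrad (x : ℂ × ℂ × ℂ) : Fin 2 → ℂ :=
  ![-(a * x.2.1 + a' * (x.2.2 * x.1)) * aeval (blowPoint a b a' b' x) G
      + x.2.2 ^ 2 * x.2.1 * x.1 * d1 G 0 (blowPoint a b a' b' x),
    (x.2.1 + x.2.2 * x.1) * aeval (blowPoint a b a' b' x) G
      + x.2.2 ^ 2 * x.2.1 * x.1 * d1 G 1 (blowPoint a b a' b' x)]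

/-- The centre of curvature in the coordinates `(w, s, t)`, analytically extended to `t = 0`. -/
noncomputable def blowCenter (x : ℂ × ℂ × ℂ) (i : Fin 2) : ℂ :=
  blowPoint a b a' b' x i + blowGrad a b a' b' G x i *
    (blowGrad a b a' b' G x 0 ^ 2 + blowGrad a b a' b' G x 1 ^ 2) /
      (x.2.1 * x.1 * nodalFormAt a b a' b' G (blowPoint a b a' b' x))

/-- `aeval` of the equation of the curve divided by `t³` in the coordinates `(w, s, t)`. -/
noncomputable def blowEq (x : ℂ × ℂ × ℂ) : ℂ :=
  x.2.1 * x.1 * aeval (blowPoint a b a' b' x) G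

variable {a a'}

lemma lineVal_blowPoint_left (h : a ≠ a') (x : ℂ × ℂ × ℂ) :
    lineVal a b (blowPoint a b a' b' x) = x.2.2 ^ 2 * x.1 := by
  have : (a : ℂ) - a' ≠ 0 := sub_ne_zero.2 (by exact_mod_cast h)
  simp [lineVal, blowPoint]
  field_simp
  ring

lemma lineVal_blowPoint_right (h : a ≠ a') (x : ℂ × ℂ × ℂ) :
    lineVal a' b' (blowPoint a b a' b' x) = x.2.2 * x.2.1 := by
  have : (a : ℂ) - a' ≠ 0 := sub_ne_zero.2 (by exact_mod_cast h)
  simp [lineVal, blowPoint, nodeX]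
  field_simp
  ring

/-- A point is recovered from the values of the two line equations. -/
lemma blowPoint_of_lineVal (h : a ≠ a') {q : Fin 2 → ℂ} {x : ℂ × ℂ × ℂ}
    (h₁ : lineVal a b q = x.2.2 ^ 2 * x.1) (h₂ : lineVal a' b' q = x.2.2 * x.2.1) :
    blowPoint a b a' b' x = q := by
  have hne : (a : ℂ) - a' ≠ 0 := sub_ne_zero.2 (by exact_mod_cast h)
  ext i
  fin_cases i
  · simp [blowPoint, nodeX, ← h₁, ← h₂, lineVal]
    field_simp
    ring
  · simp [blowPoint, nodeX, ← h₁, ← h₂, lineVal]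
    field_simp
    ring

lemma blowPoint_zero (w s : ℂ) : blowPoint a b a' b' (w, s, 0) = toComplex (node a b a' b') := by
  ext i
  fin_cases i <;> simp [blowPoint, toComplex, node]

lemma lineVal_node_left : lineVal a b (toComplex (node a b a' b')) = 0 := by
  simp [lineVal, toComplex, node]

lemma lineVal_node_right (h : a ≠ a') : lineVal a' b' (toComplex (node a b a' b')) = 0 := by
  have hne : (a : ℂ) - a' ≠ 0 := sub_ne_zero.2 (by exact_mod_cast h)
  simp [lineVal, toComplex, node, nodeX]
  field_simp
  ring

lemma d1_blowPoint (h : a ≠ a') (x : ℂ × ℂ × ℂ) (i : Fin 2) :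
    d1 (lineEq a b * lineEq a' b' * G) i (blowPoint a b a' b' x) =
      x.2.2 * blowGrad a b a' b' G x i := by
  fin_cases i
  · simp [d1_node_zero, lineVal_blowPoint_left b b' h, lineVal_blowPoint_right b b' h, blowGrad]
    ring
  · simp [d1_node_one, lineVal_blowPoint_left b b' h, lineVal_blowPoint_right b b' h, blowGrad]
    ring

lemma curvatureForm_blowPoint (h : a ≠ a') (x : ℂ × ℂ × ℂ) :
    curvatureForm (lineEq a b * lineEq a' b' * G) (blowPoint a b a' b' x) =
      x.2.2 ^ 3 * (x.2.1 * x.1 * nodalFormAt a b a' b' G (blowPoint a b a' b' x)) := by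
  rw [curvatureForm_node, lineVal_blowPoint_left b b' h, lineVal_blowPoint_right b b' h]
  ring

lemma aeval_blowPoint (h : a ≠ a') (x : ℂ × ℂ × ℂ) :
    aeval (blowPoint a b a' b' x) (lineEq a b * lineEq a' b' * G) =
      x.2.2 ^ 3 * blowEq a b a' b' G x := by
  simp only [map_mul, aeval_lineEq]
  rw [lineVal_blowPoint_left b b' h, lineVal_blowPoint_right b b' h, blowEq]
  ring

/-- The gradient has a factor `t`, so the numerator and the curvature form both have a factor `t ^
3`, which cancels. The weights `2` and `1` of `u` and `v` are the ones for which the limit centre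
stays at finite nonzero distance from the node. -/
lemma curvatureCenter_blowPoint (h : a ≠ a') {x : ℂ × ℂ × ℂ} (ht : x.2.2 ≠ 0) :
    curvatureCenter (lineEq a b * lineEq a' b' * G) (blowPoint a b a' b' x) =
      blowCenter a b a' b' G x := by
  ext i
  simp only [curvatureCenter, blowCenter, curvatureForm_blowPoint b b' G h, d1_blowPoint b b' G h]
  congr 1
  rw [show x.2.2 * blowGrad a b a' b' G x i * ((x.2.2 * blowGrad a b a' b' G x 0) ^ 2
    + (x.2.2 * blowGrad a b a' b' G x 1) ^ 2) = x.2.2 ^ 3 * (blowGrad a b a' b' G x i *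
    (blowGrad a b a' b' G x 0 ^ 2 + blowGrad a b a' b' G x 1 ^ 2)) by ring]
  exact mul_div_mul_left _ _ (pow_ne_zero 3 ht)

lemma blowGrad_zero (w s : ℂ) : blowGrad a b a' b' G (w, s, 0) =
    ![-(a * s) * aeval (toComplex (node a b a' b')) G,
      s * aeval (toComplex (node a b a' b')) G] := by
  ext i
  fin_cases i <;> simp [blowGrad, blowPoint_zero]

lemma blowCenter_zero_one (h : a ≠ a') (hG : aeval (toComplex (node a b a' b')) G ≠ 0)
    {w s : ℂ} (hw : w ≠ 0) :
    blowCenter a b a' b' G (w, s, 0) 1 =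
      node a b a' b' 1 + (1 + a ^ 2) * s ^ 2 / (2 * (a - a') ^ 2 * w) := by
  have hne : (a : ℂ) - a' ≠ 0 := sub_ne_zero.2 (by exact_mod_cast h)
  simp only [blowCenter, blowGrad_zero, blowPoint_zero]
  rw [nodalFormAt_node _ _ _ _ _ _ (lineVal_node_left b b') (lineVal_node_right b b' h)]
  simp only [toComplex, Matrix.cons_val_one, Matrix.cons_val_zero] at hG ⊢
  field_simp
  ring

lemma blowCenter_zero_zero (w s : ℂ) :
    blowCenter a b a' b' G (w, s, 0) 0 =
      node a b a' b' 0 - a * (blowCenter a b a' b' G (w, s, 0) 1 - node a b a' b' 1) := by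
  simp only [blowCenter, blowGrad_zero, blowPoint_zero, Matrix.cons_val_one, Matrix.cons_val_zero,
    toComplex]
  ring

lemma analyticAt_coord_one (x : ℂ × ℂ × ℂ) : AnalyticAt ℂ (fun x : ℂ × ℂ × ℂ => x.1) x :=
  analyticAt_fst

lemma analyticAt_coord_two (x : ℂ × ℂ × ℂ) : AnalyticAt ℂ (fun x : ℂ × ℂ × ℂ => x.2.1) x :=
  AnalyticAt.fun_comp analyticAt_fst analyticAt_snd

lemma analyticAt_coord_three (x : ℂ × ℂ × ℂ) : AnalyticAt ℂ (fun x : ℂ × ℂ × ℂ => x.2.2) x :=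
  AnalyticAt.fun_comp analyticAt_snd analyticAt_snd

lemma analyticAt_blowPoint (x : ℂ × ℂ × ℂ) (i : Fin 2) :
    AnalyticAt ℂ (fun x => blowPoint a b a' b' x i) x := by
  have c1 := analyticAt_coord_one x
  have c2 := analyticAt_coord_two x
  have c3 := analyticAt_coord_three x
  fin_cases i <;> simp [blowPoint, div_eq_mul_inv] <;> fun_prop

lemma analyticAt_aeval_blowPoint (p : MvPolynomial (Fin 2) ℝ) (x : ℂ × ℂ × ℂ) :
    AnalyticAt ℂ (fun x => aeval (blowPoint a b a' b' x) p) x :=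
  AnalyticAt.aeval_mvPolynomial (analyticAt_blowPoint b b' x) p

lemma analyticAt_blowEq (x : ℂ × ℂ × ℂ) : AnalyticAt ℂ (blowEq a b a' b' G) x := by
  have c1 := analyticAt_coord_one x
  have c2 := analyticAt_coord_two x
  have := analyticAt_aeval_blowPoint (a := a) (a' := a') b b' G x
  unfold blowEq
  fun_prop

lemma analyticAt_nodalForm (α α' : ℂ) {u v g gx gy gxx gxy gyy : ℂ × ℂ × ℂ → ℂ} {x : ℂ × ℂ × ℂ}
    (hu : AnalyticAt ℂ u x) (hv : AnalyticAt ℂ v x) (hg : AnalyticAt ℂ g x)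
    (hgx : AnalyticAt ℂ gx x) (hgy : AnalyticAt ℂ gy x) (hgxx : AnalyticAt ℂ gxx x)
    (hgxy : AnalyticAt ℂ gxy x) (hgyy : AnalyticAt ℂ gyy x) :
    AnalyticAt ℂ (fun x => nodalForm α α' (u x) (v x) (g x) (gx x) (gy x) (gxx x) (gxy x) (gyy x))
      x := by
  unfold nodalForm
  fun_prop

lemma analyticAt_nodalFormAt_blowPoint (x : ℂ × ℂ × ℂ) :
    AnalyticAt ℂ (fun x => nodalFormAt a b a' b' G (blowPoint a b a' b' x)) x := by
  have h := fun p => analyticAt_aeval_blowPoint (a := a) (a' := a') b b' p x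
  have h0 := analyticAt_blowPoint (a := a) (a' := a') b b' x 0
  have h1 := analyticAt_blowPoint (a := a) (a' := a') b b' x 1
  have hl : ∀ α β : ℝ, AnalyticAt ℂ (fun x => lineVal α β (blowPoint a b a' b' x)) x := by
    intro α β
    unfold lineVal
    fun_prop
  exact analyticAt_nodalForm _ _ (hl _ _) (hl _ _) (h _) (h _) (h _) (h _) (h _) (h _)

lemma analyticAt_blowGrad (x : ℂ × ℂ × ℂ) (i : Fin 2) :
    AnalyticAt ℂ (fun x => blowGrad a b a' b' G x i) x := by
  have c1 := analyticAt_coord_one x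
  have c2 := analyticAt_coord_two x
  have c3 := analyticAt_coord_three x
  have h := fun p => analyticAt_aeval_blowPoint (a := a) (a' := a') b b' p x
  have e := h G
  have e0 := h (pderiv 0 G)
  have e1 := h (pderiv 1 G)
  fin_cases i <;> simp [blowGrad, d1] <;> fun_prop

lemma analyticAt_blowCenter {x : ℂ × ℂ × ℂ} (hw : x.1 ≠ 0) (hs : x.2.1 ≠ 0)
    (hK : nodalFormAt a b a' b' G (blowPoint a b a' b' x) ≠ 0) (i : Fin 2) :
    AnalyticAt ℂ (fun x => blowCenter a b a' b' G x i) x := by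
  have c1 := analyticAt_coord_one x
  have c2 := analyticAt_coord_two x
  have h := analyticAt_blowPoint (a := a) (a' := a') b b' x i
  have h0 := analyticAt_blowGrad (a := a) (a' := a') b b' G x 0
  have h1 := analyticAt_blowGrad (a := a) (a' := a') b b' G x 1
  have hi := analyticAt_blowGrad (a := a) (a' := a') b b' G x i
  have hk := analyticAt_nodalFormAt_blowPoint (a := a) (a' := a') b b' G x
  unfold blowCenter
  refine h.add (AnalyticAt.div (by fun_prop) (by fun_prop) ?_)
  exact mul_ne_zero (mul_ne_zero hs hw) hK

/-- The map whose local inverse parametrizes the evolute near the normal at a node. -/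
noncomputable def blowMap (a b a' b' : ℝ) (G : MvPolynomial (Fin 2) ℝ) (x : ℂ × ℂ × ℂ) :
    ℂ × ℂ × ℂ :=
  (blowEq a b a' b' G x, blowCenter a b a' b' G x 1, x.2.2)

/-- At `t = 0` the first two components are, up to nonzero factors and an additive constant, `s * w`
and `s ^ 2 / w`. Their logarithmic differentials `ds/s + dw/w` and `2 ds/s - dw/w` are independent.
-/
lemma fderiv_blowMap_injective (h : a ≠ a') (hG : aeval (toComplex (node a b a' b')) G ≠ 0)
    {w s : ℂ} (hw : w ≠ 0) (hs : s ≠ 0)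
    (hA : AnalyticAt ℂ (fun x => blowCenter a b a' b' G x 1) (w, s, 0)) (v : ℂ × ℂ × ℂ)
    (hv : fderiv ℂ (blowMap a b a' b' G) (w, s, 0) v = 0) : v = 0 := by
  obtain ⟨dw, ds, dt⟩ := v
  have hne : (a : ℂ) - a' ≠ 0 := sub_ne_zero.2 (by exact_mod_cast h)
  have ha : (1 + (a : ℂ) ^ 2) ≠ 0 := by
    have : (1 + a ^ 2) ≠ 0 := by positivity
    exact_mod_cast this
  have hE := (analyticAt_blowEq (a := a) (a' := a') b b' G (w, s, 0)).differentiableAt.hasFDerivAt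
  have hC := hA.differentiableAt.hasFDerivAt
  have hT : HasFDerivAt (fun x : ℂ × ℂ × ℂ => x.2.2)
      ((ContinuousLinearMap.snd ℂ ℂ ℂ).comp (ContinuousLinearMap.snd ℂ ℂ (ℂ × ℂ))) (w, s, 0) :=
    ((ContinuousLinearMap.snd ℂ ℂ ℂ).comp (ContinuousLinearMap.snd ℂ ℂ (ℂ × ℂ))).hasFDerivAt
  have hD := hE.prodMk (hC.prodMk hT)
  rw [show fderiv ℂ (blowMap a b a' b' G) (w, s, 0) = _ from hD.fderiv] at hv
  simp only [ContinuousLinearMap.prod_apply, Prod.mk_eq_zero, ContinuousLinearMap.comp_apply,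
    ContinuousLinearMap.coe_snd'] at hv
  obtain ⟨h1, h2, rfl⟩ := hv
  -- A kernel vector has zero third component, so it is enough to differentiate along a line inside
  -- `t = 0`, where the explicit formulas hold.
  have hline : HasDerivAt (fun r : ℂ => ((w, s, 0) : ℂ × ℂ × ℂ) + r • (dw, ds, (0 : ℂ)))
      (dw, ds, 0) 0 := by
    simpa using ((hasDerivAt_id (0 : ℂ)).smul_const ((dw, ds, (0 : ℂ)) : ℂ × ℂ × ℂ)).const_add
      ((w, s, 0) : ℂ × ℂ × ℂ)
  have hW : HasDerivAt (fun r : ℂ => w + r * dw) dw 0 := by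
    simpa using ((hasDerivAt_id (0 : ℂ)).mul_const dw).const_add w
  have hS : HasDerivAt (fun r : ℂ => s + r * ds) ds 0 := by
    simpa using ((hasDerivAt_id (0 : ℂ)).mul_const ds).const_add s
  have h1' := HasFDerivAt.comp_hasDerivAt_of_eq (0 : ℂ) hE hline (by simp)
  have h2' := HasFDerivAt.comp_hasDerivAt_of_eq (0 : ℂ) hC hline (by simp)
  rw [h1] at h1'
  rw [h2] at h2'
  have k1 := (hS.mul hW).mul_const (aeval (toComplex (node a b a' b')) G)
  have k2 := (((hS.pow 2).const_mul (1 + (a : ℂ) ^ 2)).div (hW.const_mul (2 * ((a : ℂ) - a') ^ 2))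
    (by simp [hne, hw])).const_add ((node a b a' b' 1 : ℝ) : ℂ)
  have e1 := h1'.unique (k1.congr_of_eventuallyEq (by
    refine Eventually.of_forall fun r => ?_
    simp [blowEq, blowPoint_zero]))
  have e2 := h2'.unique (k2.congr_of_eventuallyEq (by
    have c1 : ∀ᶠ r : ℂ in 𝓝 0, w + r * dw ≠ 0 := hW.continuousAt.eventually_ne (by simpa using hw)
    filter_upwards [c1] with r r1
    have := blowCenter_zero_one b b' G h hG r1 (s := s + r * ds)
    simpa using this))
  simp only [zero_mul, add_zero, Pi.pow_apply] at e1 e2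
  have e1' : ds * w + s * dw = 0 := by
    have := e1.symm
    rcases mul_eq_zero.1 this with h | h
    · exact h
    · exact absurd h hG
  have e2' : 2 * ds * w - s * dw = 0 := by
    have := e2.symm
    rw [div_eq_zero_iff] at this
    rcases this with h | h
    · have h3 : ((1 + (a : ℂ) ^ 2) * (2 * ((a : ℂ) - a') ^ 2) * s) * (2 * ds * w - s * dw) = 0 := by
        rw [← h]; push_cast; ring
      rcases mul_eq_zero.1 h3 with h4 | h4
      · exfalso; revert h4; simp [ha, hne, hs]
      · exact h4
    · exfalso; revert h; simp [hne, hw]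
  have e3 : ds = 0 := by
    have : 3 * w * ds = 0 := by linear_combination e1' + e2'
    simpa [hw] using this
  have e4 : dw = 0 := by
    rw [e3] at e1'
    simpa [hs] using e1'
  simp [e3, e4]

lemma blowPoint_star (x : ℂ × ℂ × ℂ) (i : Fin 2) :
    blowPoint a b a' b' (star x) i = star (blowPoint a b a' b' x i) := by
  fin_cases i <;> simp [blowPoint]

lemma aeval_blowPoint_star (p : MvPolynomial (Fin 2) ℝ) (x : ℂ × ℂ × ℂ) :
    aeval (blowPoint a b a' b' (star x)) p = star (aeval (blowPoint a b a' b' x) p) := by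
  rw [show blowPoint a b a' b' (star x) = fun i => star (blowPoint a b a' b' x i) from
    funext (blowPoint_star b b' x)]
  exact aeval_conj p _

lemma blowEq_star (x : ℂ × ℂ × ℂ) :
    blowEq a b a' b' G (star x) = star (blowEq a b a' b' G x) := by
  simp [blowEq, aeval_blowPoint_star]

lemma blowGrad_star (x : ℂ × ℂ × ℂ) (i : Fin 2) :
    blowGrad a b a' b' G (star x) i = star (blowGrad a b a' b' G x i) := by
  fin_cases i <;> simp [blowGrad, d1, aeval_blowPoint_star]

lemma nodalFormAt_blowPoint_star (x : ℂ × ℂ × ℂ) :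
    nodalFormAt a b a' b' G (blowPoint a b a' b' (star x)) =
      star (nodalFormAt a b a' b' G (blowPoint a b a' b' x)) := by
  simp [nodalFormAt, nodalForm, d1, d2, lineVal, aeval_blowPoint_star, blowPoint_star]

lemma blowCenter_star (x : ℂ × ℂ × ℂ) (i : Fin 2) :
    blowCenter a b a' b' G (star x) i = star (blowCenter a b a' b' G x i) := by
  simp [blowCenter, blowGrad_star, nodalFormAt_blowPoint_star, blowPoint_star]

/-- All the data are real, so the map commutes with conjugation; uniqueness of local preimages then
makes the branch real at real arguments. -/
lemma blowMap_star (x : ℂ × ℂ × ℂ) :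
    blowMap a b a' b' G (star x) = star (blowMap a b a' b' G x) := by
  simp [blowMap, blowEq_star, blowCenter_star, Prod.ext_iff]

/-- Near a point of the normal to one line of a node the evolutes of the smoothings contain an
analytic family of graphs, which tend to the normal. -/
lemma exists_branch (h : a ≠ a') (hG : aeval (toComplex (node a b a' b')) G ≠ 0) {w s p : ℝ}
    (hw : w ≠ 0) (hs : s ≠ 0) (hE : (s : ℂ) * w * aeval (toComplex (node a b a' b')) G = 1)
    (hp : node a b a' b' 1 + (1 + a ^ 2) * s ^ 2 / (2 * (a - a') ^ 2 * w) = p) :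
    ∃ φ : ℂ × ℂ → ℂ, AnalyticAt ℂ φ (p, 0) ∧
      (∀ᶠ y : ℂ in 𝓝 (p : ℂ), φ (y, 0) = node a b a' b' 0 - a * (y - node a b a' b' 1)) ∧
      (∀ᶠ x : ℝ × ℝ in 𝓝 (p, 0), (φ (x.1, x.2)).im = 0) ∧
      (∀ᶠ x : ℂ × ℂ in 𝓝 ((p : ℂ), (0 : ℂ)), x.2 ≠ 0 → ∃ q : Fin 2 → ℂ,
        aeval q (lineEq a b * lineEq a' b' * G) = x.2 ^ 3 ∧
        curvatureForm (lineEq a b * lineEq a' b' * G) q ≠ 0 ∧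
        curvatureCenter (lineEq a b * lineEq a' b' * G) q = ![φ x, x.1]) ∧
      ∀ᶠ x : ℂ × ℂ × ℂ in 𝓝 ((w : ℂ), (s : ℂ), (0 : ℂ)), blowEq a b a' b' G x = 1 →
        blowCenter a b a' b' G x 0 = φ (blowCenter a b a' b' G x 1, x.2.2) := by
  have hwc : (w : ℂ) ≠ 0 := by exact_mod_cast hw
  have hsc : (s : ℂ) ≠ 0 := by exact_mod_cast hs
  have hne : (a : ℂ) - a' ≠ 0 := sub_ne_zero.2 (by exact_mod_cast h)
  set x₀ : ℂ × ℂ × ℂ := ((w : ℂ), (s : ℂ), (0 : ℂ)) with hx₀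
  have hK : nodalFormAt a b a' b' G (blowPoint a b a' b' x₀) ≠ 0 := by
    rw [hx₀, blowPoint_zero,
      nodalFormAt_node _ _ _ _ _ _ (lineVal_node_left b b') (lineVal_node_right b b' h)]
    simp [hne, hG]
  have hA : ∀ i, AnalyticAt ℂ (fun x => blowCenter a b a' b' G x i) x₀ :=
    analyticAt_blowCenter b b' G hwc hsc hK
  have hM : AnalyticAt ℂ (blowMap a b a' b' G) x₀ :=
    (analyticAt_blowEq b b' G x₀).prod ((hA 1).prod (analyticAt_coord_three x₀))
  have hM0 : blowMap a b a' b' G x₀ = (1, (p : ℂ), 0) := by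
    simp only [blowMap]
    rw [hx₀, blowCenter_zero_one b b' G h hG hwc, blowEq, blowPoint_zero, ← hp]
    simp [hE]
  obtain ⟨g, hg, hg0, hl, hr⟩ := exists_analytic_inverse hM
    (fderiv_blowMap_injective b b' G h hG hwc hsc (hA 1))
  rw [hM0] at hg hg0 hr
  have hι : AnalyticAt ℂ (fun y : ℂ × ℂ => ((1 : ℂ), y.1, y.2)) ((p : ℂ), (0 : ℂ)) :=
    analyticAt_const.prod (analyticAt_fst.prod analyticAt_snd)
  have hιc : Tendsto (fun y : ℂ × ℂ => ((1 : ℂ), y.1, y.2)) (𝓝 ((p : ℂ), (0 : ℂ)))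
      (𝓝 ((1 : ℂ), (p : ℂ), (0 : ℂ))) := hι.continuousAt
  have hgc : Tendsto g (𝓝 ((1 : ℂ), (p : ℂ), (0 : ℂ))) (𝓝 x₀) := by
    have := hg.continuousAt
    rwa [ContinuousAt, hg0] at this
  have hr' : ∀ᶠ y : ℂ × ℂ in 𝓝 ((p : ℂ), (0 : ℂ)),
      blowMap a b a' b' G (g (1, y.1, y.2)) = (1, y.1, y.2) := hιc.eventually hr
  have hgι : Tendsto (fun y : ℂ × ℂ => g (1, y.1, y.2)) (𝓝 ((p : ℂ), (0 : ℂ))) (𝓝 x₀) :=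
    hgc.comp hιc
  refine ⟨fun y => blowCenter a b a' b' G (g (1, y.1, y.2)) 0, ?_, ?_, ?_, ?_, ?_⟩
  · have h0 : AnalyticAt ℂ (fun x => blowCenter a b a' b' G x 0) (g (1, (p : ℂ), 0)) := by
      rw [hg0]; exact hA 0
    exact AnalyticAt.fun_comp (h0.fun_comp hg) hι
  · have hc : Tendsto (fun y : ℂ => (y, (0 : ℂ))) (𝓝 (p : ℂ)) (𝓝 ((p : ℂ), (0 : ℂ))) :=
      (continuous_id.prodMk continuous_const).tendsto _
    filter_upwards [hc.eventually hr'] with y hy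
    set x := g (1, y, 0) with hx
    have h3 : x.2.2 = 0 := congrArg (fun z => z.2.2) hy
    have h2 : blowCenter a b a' b' G x 1 = y := congrArg (fun z => z.2.1) hy
    have hx' : x = (x.1, x.2.1, 0) := by rw [← h3]
    change blowCenter a b a' b' G x 0 = _
    rw [hx', blowCenter_zero_zero, ← hx', h2]
  · have hc : Tendsto (fun y : ℝ × ℝ => ((y.1 : ℂ), (y.2 : ℂ))) (𝓝 (p, 0))
        (𝓝 ((p : ℂ), (0 : ℂ))) :=
      Continuous.tendsto' (by fun_prop) _ _ (by simp)
    have hstar : Tendsto (fun x : ℂ × ℂ × ℂ => star x) (𝓝 x₀) (𝓝 x₀) :=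
      continuous_star.tendsto' _ _ (by simp [hx₀, Prod.ext_iff])
    filter_upwards [hc.eventually hr', hc.eventually (hgι.eventually hl),
      hc.eventually (hgι.eventually (hstar.eventually hl))] with y h1 h2 h3
    set x := g (1, (y.1 : ℂ), (y.2 : ℂ)) with hx
    -- Both `x` and its conjugate are preimages near `x₀` of the same real point, so they agree.
    have h4 : star x = x := by
      rw [← h3, blowMap_star, h1, ← h2, h1]
      congr 1
      simp [Prod.ext_iff]
    have h5 := blowCenter_star (a := a) (a' := a') b b' G x 0
    rw [h4] at h5
    exact Complex.conj_eq_iff_im.1 h5.symm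
  · have e1 := hgι.eventually ((analyticAt_coord_one x₀).continuousAt.eventually_ne hwc)
    have e2 := hgι.eventually ((analyticAt_coord_two x₀).continuousAt.eventually_ne hsc)
    have e3 := hgι.eventually
      ((analyticAt_nodalFormAt_blowPoint b b' G x₀).continuousAt.eventually_ne hK)
    filter_upwards [e1, e2, e3, hr'] with y h1 h2 h3 h4 hy
    set x := g (1, y.1, y.2) with hx
    have k3 : x.2.2 = y.2 := congrArg (fun z => z.2.2) h4
    have k2 : blowCenter a b a' b' G x 1 = y.1 := congrArg (fun z => z.2.1) h4
    have k1 : blowEq a b a' b' G x = 1 := congrArg (fun z => z.1) h4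
    have k4 : x.2.2 ≠ 0 := k3 ▸ hy
    refine ⟨blowPoint a b a' b' x, ?_, ?_, ?_⟩
    · rw [aeval_blowPoint b b' G h, k1, k3, mul_one]
    · rw [curvatureForm_blowPoint b b' G h]
      exact mul_ne_zero (pow_ne_zero 3 k4) (mul_ne_zero (mul_ne_zero h2 h1) h3)
    · rw [curvatureCenter_blowPoint b b' G h k4]
      ext i
      fin_cases i
      · rfl
      · exact k2
  -- By the left inverse property, a point near `x₀` on the rescaled curve is the one parametrized
  -- by its own second centre coordinate and its own `t`.
  · filter_upwards [hl] with x hx h1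
    have : blowMap a b a' b' G x = (1, blowCenter a b a' b' G x 1, x.2.2) := by
      rw [blowMap, h1]
    rw [this] at hx
    simp only [hx]

end Branch

/-! ### Asymptotics of centres of curvature near a node -/

lemma exists_ultrafilter_tendsto {α E : Type*} [NormedAddCommGroup E] [ProperSpace E]
    (𝒰 : Ultrafilter α) (f : α → E) (R : ℝ) (h : ∀ᶠ x in 𝒰, ‖f x‖ ≤ R) :
    ∃ e, Tendsto f 𝒰 (𝓝 e) := by
  have hc := isCompact_closedBall (0 : E) R
  obtain ⟨e, -, he⟩ := hc.ultrafilter_le_nhds (𝒰.map f) (by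
    rw [le_principal_iff]
    exact h.mono fun x hx => by simpa using hx)
  exact ⟨e, he⟩

section Node

variable {α : Type*} {a b a' b' : ℝ} {G : MvPolynomial (Fin 2) ℝ} {q c : α → Fin 2 → ℂ}

/-- The linear form which vanishes on the normals to the lines of slope `a`. -/
def normalForm (a : ℝ) (z : Fin 2 → ℂ) : ℂ := z 0 + a * z 1

/-- The normal equation at a point near a node. -/
lemma normal_node (q : Fin 2 → ℂ) (c : Fin 2 → ℂ)
    (hc : c = curvatureCenter (lineEq a b * lineEq a' b' * G) q) :
    lineVal a' b' q * (aeval q G * normalForm a (c - q)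
        + lineVal a b q * ((c 0 - q 0) * d1 G 1 q - (c 1 - q 1) * d1 G 0 q))
      = -(lineVal a b q * (aeval q G * normalForm a' (c - q))) := by
  have h := center_normal (lineEq a b * lineEq a' b' * G) q
  rw [← hc, d1_node_zero, d1_node_one] at h
  simp only [normalForm, Pi.sub_apply]
  linear_combination h

lemma normal_node' (q : Fin 2 → ℂ) (c : Fin 2 → ℂ)
    (hc : c = curvatureCenter (lineEq a b * lineEq a' b' * G) q) :
    lineVal a b q * (aeval q G * normalForm a' (c - q)
        + lineVal a' b' q * ((c 0 - q 0) * d1 G 1 q - (c 1 - q 1) * d1 G 0 q))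
      = -(lineVal a' b' q * (aeval q G * normalForm a (c - q))) := by
  linear_combination normal_node q c hc

/-- A limit of centres of curvature near a node lies on one of the two normals at the node. -/
lemma normalForm_eq_zero_of_tendsto {l : Filter α} [l.NeBot] {n p : Fin 2 → ℂ} (h : a ≠ a')
    (hn : lineVal a b n = 0) (hn' : lineVal a' b' n = 0) (hG : aeval n G ≠ 0)
    (hc : ∀ x, c x = curvatureCenter (lineEq a b * lineEq a' b' * G) (q x))
    (hκ : ∀ᶠ x in l, curvatureForm (lineEq a b * lineEq a' b' * G) (q x) ≠ 0)
    (hq : Tendsto q l (𝓝 n)) (hp : Tendsto c l (𝓝 p)) (hpn : p ≠ n) :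
    normalForm a (p - n) = 0 ∨ normalForm a' (p - n) = 0 := by
  by_contra! hcon
  obtain ⟨hA, hA'⟩ := hcon
  have hne : (a : ℂ) - a' ≠ 0 := sub_ne_zero.2 (by exact_mod_cast h)
  have hu := ((continuous_lineVal a b).tendsto n).comp hq
  have hv := ((continuous_lineVal a' b').tendsto n).comp hq
  have hg := ((continuous_aeval_real G).tendsto n).comp hq
  have hgx := ((continuous_d1 G 0).tendsto n).comp hq
  have hgy := ((continuous_d1 G 1).tendsto n).comp hq
  have hK := ((continuous_nodalFormAt a b a' b' G).tendsto n).comp hq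
  have hcq := hp.sub hq
  have hcqi := fun i => (tendsto_pi_nhds.1 hp i).sub (tendsto_pi_nhds.1 hq i)
  have hNF : ∀ e, Continuous (normalForm e) := fun e => by unfold normalForm; fun_prop
  have hNA := ((hNF a).tendsto _).comp hcq
  have hNA' := ((hNF a').tendsto _).comp hcq
  simp only [Function.comp_def] at hu hv hg hgx hgy hK hNA hNA'
  rw [hn] at hu
  rw [hn'] at hv
  have hM := ((hcqi 0).mul hgy).sub ((hcqi 1).mul hgx)
  have hden := (hg.mul hNA).add (hu.mul hM)
  rw [zero_mul, add_zero] at hden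
  have hden0 := hden.eventually_ne (mul_ne_zero hG hA)
  -- The normal equation makes `v / u` converge to `ρ`, which is finite and nonzero when `p` is off
  -- both normals.
  set ρ := -(aeval n G * normalForm a' (p - n)) / (aeval n G * normalForm a (p - n)) with hρ
  have hρ0 : ρ ≠ 0 := div_ne_zero (neg_ne_zero.2 (mul_ne_zero hG hA')) (mul_ne_zero hG hA)
  obtain ⟨r, hr, hvr⟩ : ∃ r : α → ℂ, Tendsto r l (𝓝 ρ) ∧
      ∀ᶠ x in l, lineVal a' b' (q x) = lineVal a b (q x) * r x := by
    refine ⟨_, ((hg.mul hNA').neg).div hden (mul_ne_zero hG hA), ?_⟩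
    filter_upwards [hden0] with x hx
    have := normal_node (q x) (c x) (hc x)
    rw [Pi.div_apply]
    field_simp
    linear_combination this
  -- With `u` and `v` comparable, the gradient is `O(u)` while the curvature form `u * v * K` has
  -- exact order `u ^ 2`. Hence `c - q` is `O(u)`, and the centres would tend to the node.
  have key : ∀ i, (p i - n i) * ρ * nodalFormAt a b a' b' G n = 0 := by
    intro i
    have hL := ((hcqi i).mul hr).mul hK
    have hd : ∀ j, ∃ e : ℂ, Tendsto (fun x => ![
        -(a * r x + a') * aeval (q x) G + lineVal a' b' (q x) * d1 G 0 (q x),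
        (r x + 1) * aeval (q x) G + lineVal a' b' (q x) * d1 G 1 (q x)] j) l (𝓝 e) := by
      intro j
      fin_cases j
      · exact ⟨_, ((((hr.const_mul (a : ℂ)).add_const (a' : ℂ)).neg).mul hg).add (hv.mul hgx)⟩
      · exact ⟨_, ((hr.add_const (1 : ℂ)).mul hg).add (hv.mul hgy)⟩
    choose e he using hd
    have hR := hu.mul ((he i).mul (((he 0).pow 2).add ((he 1).pow 2)))
    rw [zero_mul] at hR
    refine tendsto_nhds_unique (hL.congr' ?_) hR
    filter_upwards [hvr, hκ] with x hv hκx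
    have hk := hκx
    rw [curvatureForm_node] at hk
    have hu0 : lineVal a b (q x) ≠ 0 := left_ne_zero_of_mul (left_ne_zero_of_mul hk)
    have h1 := center_sub_mul _ (q x) hκx i
    rw [← hc, curvatureForm_node, d1_node_zero, d1_node_one] at h1
    apply mul_left_cancel₀ (pow_ne_zero 2 hu0)
    fin_cases i
    · simp only [Fin.zero_eta, d1_node_zero] at h1
      simp only [Fin.zero_eta, Matrix.cons_val_zero, Matrix.cons_val_one]
      rw [hv] at h1 ⊢
      linear_combination h1
    · simp only [Fin.mk_one, d1_node_one] at h1
      simp only [Fin.mk_one, Matrix.cons_val_zero, Matrix.cons_val_one]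
      rw [hv] at h1 ⊢
      linear_combination h1
  have hK0 : nodalFormAt a b a' b' G n ≠ 0 := by
    rw [nodalFormAt_node _ _ _ _ _ _ hn hn']
    simp [hne, hG]
  apply hpn
  ext i
  have := key i
  simp only [mul_eq_zero, hρ0, hK0, or_false] at this
  exact sub_eq_zero.1 this

/-- The asymptotics of the points near a node whose centre of curvature tends to a point of the
normal to one of the lines. -/
lemma exists_tendsto_blow {𝒰 : Ultrafilter α} {t : α → ℝ} {n p : Fin 2 → ℂ} (h : a ≠ a')
    (hn : lineVal a b n = 0) (hn' : lineVal a' b' n = 0) (hG : aeval n G ≠ 0)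
    (hc : ∀ x, c x = curvatureCenter (lineEq a b * lineEq a' b' * G) (q x))
    (hκ : ∀ᶠ x in 𝒰, curvatureForm (lineEq a b * lineEq a' b' * G) (q x) ≠ 0)
    (ht : ∀ᶠ x in 𝒰, t x ≠ 0) (ht0 : Tendsto t 𝒰 (𝓝 0))
    (hP : ∀ᶠ x in 𝒰, aeval (q x) (lineEq a b * lineEq a' b' * G) = (t x : ℂ) ^ 3)
    (hq : Tendsto q 𝒰 (𝓝 n)) (hp : Tendsto c 𝒰 (𝓝 p)) (hpn : p ≠ n)
    (hA : normalForm a (p - n) = 0) :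
    ∃ w s : α → ℂ, ∃ w₀ s₀ : ℂ, Tendsto w 𝒰 (𝓝 w₀) ∧ Tendsto s 𝒰 (𝓝 s₀) ∧
      (∀ᶠ x in 𝒰, lineVal a b (q x) = (t x : ℂ) ^ 2 * w x ∧
        lineVal a' b' (q x) = (t x : ℂ) * s x) ∧
      s₀ * w₀ * aeval n G = 1 ∧ (1 + (a : ℂ) ^ 2) * s₀ ^ 2 / (2 * (a - a') ^ 2 * w₀) = p 1 - n 1 ∧
      Tendsto (fun x => normalForm a (c x - n) / t x) 𝒰
        (𝓝 (3 / 2 * (1 + (a : ℂ) ^ 2) / (a - a') * s₀)) := by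
  have hne : (a : ℂ) - a' ≠ 0 := sub_ne_zero.2 (by exact_mod_cast h)
  have ha : (1 + (a : ℂ) ^ 2) ≠ 0 := by
    have : (1 + a ^ 2) ≠ 0 := by positivity
    exact_mod_cast this
  have hp0 : p 0 - n 0 = -(a * (p 1 - n 1)) := by
    simp only [normalForm, Pi.sub_apply] at hA
    linear_combination hA
  have hp1 : p 1 - n 1 ≠ 0 := by
    intro h1
    rw [h1] at hp0
    apply hpn
    ext i
    fin_cases i
    · simpa [sub_eq_zero] using hp0
    · exact sub_eq_zero.1 h1
  have hA' : normalForm a' (p - n) = (a' - a) * (p 1 - n 1) := by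
    simp only [normalForm, Pi.sub_apply]
    linear_combination hp0
  have hA'0 : normalForm a' (p - n) ≠ 0 := by
    rw [hA']
    exact mul_ne_zero (by rw [← neg_sub]; exact neg_ne_zero.2 hne) hp1
  have hu := ((continuous_lineVal a b).tendsto n).comp hq
  have hv := ((continuous_lineVal a' b').tendsto n).comp hq
  have hg := ((continuous_aeval_real G).tendsto n).comp hq
  have hgx := ((continuous_d1 G 0).tendsto n).comp hq
  have hgy := ((continuous_d1 G 1).tendsto n).comp hq
  have hK := ((continuous_nodalFormAt a b a' b' G).tendsto n).comp hq
  have hcq := hp.sub hq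
  have hcqi := fun i => (tendsto_pi_nhds.1 hp i).sub (tendsto_pi_nhds.1 hq i)
  have hNF : ∀ e, Continuous (normalForm e) := fun e => by unfold normalForm; fun_prop
  have hNA := ((hNF a).tendsto _).comp hcq
  have hNA' := ((hNF a').tendsto _).comp hcq
  simp only [Function.comp_def] at hu hv hg hgx hgy hK hNA hNA'
  rw [hn] at hu
  rw [hn'] at hv
  rw [hA] at hNA
  rw [nodalFormAt_node _ _ _ _ _ _ hn hn'] at hK
  have hM := ((hcqi 0).mul hgy).sub ((hcqi 1).mul hgx)
  have hden := (hg.mul hNA').add (hv.mul hM)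
  rw [zero_mul, add_zero] at hden
  have hden0 := hden.eventually_ne (mul_ne_zero hG hA'0)
  have hK0 : 2 * ((a : ℂ) - a') ^ 2 * aeval n G ^ 3 ≠ 0 := by simp [hne, hG]
  have hcK := (hcqi 1).mul hK
  have hcK0 := hcK.eventually_ne (mul_ne_zero hp1 hK0)
  have huv : ∀ᶠ x in 𝒰, lineVal a b (q x) ≠ 0 ∧ lineVal a' b' (q x) ≠ 0 := by
    filter_upwards [hκ] with x hx
    rw [curvatureForm_node] at hx
    exact ⟨left_ne_zero_of_mul (left_ne_zero_of_mul hx),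
      right_ne_zero_of_mul (left_ne_zero_of_mul hx)⟩
  -- the ratio `u / v`
  have hr : Tendsto (fun x => lineVal a b (q x) / lineVal a' b' (q x)) 𝒰 (𝓝 0) := by
    have := ((hg.mul hNA).neg).div hden (mul_ne_zero hG hA'0)
    rw [mul_zero, neg_zero, zero_div] at this
    refine this.congr' ?_
    filter_upwards [hden0, huv] with x hx hx'
    have h2 := normal_node' (q x) (c x) (hc x)
    have hv0 := hx'.2
    rw [Pi.div_apply, div_eq_div_iff hx hv0]
    linear_combination -h2
  -- the ratio `u / v ^ 2`
  set μ : ℂ := (1 + (a : ℂ) ^ 2) / (2 * (a - a') ^ 2 * (p 1 - n 1)) with hμ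
  have hμ0 : μ ≠ 0 := div_ne_zero ha (by simp [hne, hp1])
  have hm : Tendsto (fun x => lineVal a b (q x) / lineVal a' b' (q x) ^ 2) 𝒰 (𝓝 μ) := by
    -- Since `u / v → 0`, the gradient divided by `v` tends to `(-a, 1)` times the value of `G` at
    -- the node. The formula for the second coordinate of the centre can then be solved for the
    -- limit of `u / v ^ 2`.
    have e0 := (((((hr.const_mul (a' : ℂ)).const_add (a : ℂ)).neg).mul hg).add (hu.mul hgx))
    have e1 := ((hr.const_add (1 : ℂ)).mul hg).add (hu.mul hgy)
    have := (e1.mul ((e0.pow 2).add (e1.pow 2))).div hcK (mul_ne_zero hp1 hK0)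
    have hlim : ((1 + 0) * aeval n G + 0 * d1 G 1 n) *
        ((-(↑a + ↑a' * 0) * aeval n G + 0 * d1 G 0 n) ^ 2 +
          ((1 + 0) * aeval n G + 0 * d1 G 1 n) ^ 2) /
        ((p 1 - n 1) * (2 * ((a : ℂ) - a') ^ 2 * aeval n G ^ 3)) = μ := by
      rw [hμ]
      field_simp
      ring
    rw [hlim] at this
    refine this.congr' ?_
    filter_upwards [hcK0, huv, hκ] with x hx hx' hκx
    obtain ⟨-, hv0⟩ := hx'
    have h1 := center_sub_mul _ (q x) hκx 1
    rw [← hc, curvatureForm_node, d1_node_zero, d1_node_one] at h1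
    rw [Pi.div_apply, div_eq_div_iff hx (pow_ne_zero 2 hv0)]
    have e : lineVal a b (q x) =
      lineVal a' b' (q x) * (lineVal a b (q x) / lineVal a' b' (q x)) := by field_simp
    set r := lineVal a b (q x) / lineVal a' b' (q x) with hr
    apply mul_left_cancel₀ hv0
    rw [e] at h1 ⊢
    linear_combination -h1
  have htc : ∀ᶠ x in 𝒰, (t x : ℂ) ≠ 0 := ht.mono fun x hx => by exact_mod_cast hx
  -- The equation `u * v * G = t ^ 3`, rewritten through `v / t` and `u / v ^ 2`. It controls only
  -- the cube of `v / t`; boundedness and the ultrafilter then select one cube root as the limit.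
  have hcube : ∀ᶠ x in 𝒰, (lineVal a' b' (q x) / t x) ^ 3 *
      (lineVal a b (q x) / lineVal a' b' (q x) ^ 2 * aeval (q x) G) = 1 := by
    filter_upwards [htc, huv, hP] with x hx hx' hPx
    simp only [map_mul, aeval_lineEq] at hPx
    have hv0 := hx'.2
    field_simp
    linear_combination hPx
  have hmg := hm.mul hg
  have hmg0 := mul_ne_zero hμ0 hG
  have hs3 : Tendsto (fun x => (lineVal a' b' (q x) / t x) ^ 3) 𝒰 (𝓝 (μ * aeval n G)⁻¹) := by
    refine (hmg.inv₀ hmg0).congr' ?_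
    filter_upwards [hcube] with x hx
    exact (eq_inv_of_mul_eq_one_left hx).symm
  obtain ⟨s₀, hs⟩ := exists_ultrafilter_tendsto 𝒰 (fun x => lineVal a' b' (q x) / t x)
    (‖(μ * aeval n G)⁻¹‖ + 1) (by
      filter_upwards [hs3.norm.eventually_lt_const (lt_add_one _)] with x hx
      by_contra! hcon
      rw [norm_pow] at hx
      have h1 : 1 ≤ ‖lineVal a' b' (q x) / t x‖ :=
        le_trans (by linarith [norm_nonneg (μ * aeval n G)⁻¹]) hcon.le
      have := le_self_pow₀ h1 (by norm_num : (3 : ℕ) ≠ 0)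
      linarith)
  have hs03 : s₀ ^ 3 = (μ * aeval n G)⁻¹ := tendsto_nhds_unique (hs.pow 3) hs3
  have hs0 : s₀ ≠ 0 := by
    rintro rfl
    rw [zero_pow (by norm_num)] at hs03
    exact inv_ne_zero hmg0 hs03.symm
  refine ⟨fun x => lineVal a b (q x) / lineVal a' b' (q x) ^ 2 * (lineVal a' b' (q x) / t x) ^ 2,
    fun x => lineVal a' b' (q x) / t x, μ * s₀ ^ 2, s₀, hm.mul (hs.pow 2), hs, ?_, ?_, ?_, ?_⟩
  · filter_upwards [htc, huv] with x hx hx'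
    have hv0 := hx'.2
    constructor <;> field_simp
  · have : s₀ * (μ * s₀ ^ 2) * aeval n G = s₀ ^ 3 * (μ * aeval n G) := by ring
    rw [this, hs03, inv_mul_cancel₀ hmg0]
  · rw [hμ]
    field_simp
  -- The deviation splits into a part from `c - q`, by the normal equation, and a part from `q - n`.
  -- In units of `(1 + a ^ 2) / (a - a') * s₀` they contribute `1 / 2` and `1`, whence the factor `3
  -- / 2`.
  · have e1 : Tendsto (fun x => -(lineVal a b (q x) / lineVal a' b' (q x) ^ 2 *
        (lineVal a' b' (q x) / t x) * ((aeval (q x) G * normalForm a' (c x - q x)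
          + lineVal a' b' (q x) * ((c x 0 - q x 0) * d1 G 1 (q x)
            - (c x 1 - q x 1) * d1 G 0 (q x))) / aeval (q x) G))
        + ((1 + (a : ℂ) ^ 2) * (lineVal a' b' (q x) / t x)
          - (1 + a * a') * (t x * (lineVal a b (q x) / lineVal a' b' (q x) ^ 2 *
            (lineVal a' b' (q x) / t x) ^ 2))) / (a - a')) 𝒰
        (𝓝 (-(μ * s₀ * (aeval n G * normalForm a' (p - n) / aeval n G))
          + ((1 + (a : ℂ) ^ 2) * s₀ - (1 + a * a') * (0 * (μ * s₀ ^ 2))) / (a - a'))) := by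
      have htc0 : Tendsto (fun x => (t x : ℂ)) 𝒰 (𝓝 0) := by
        have := (Complex.continuous_ofReal.tendsto 0).comp ht0
        simpa [Function.comp_def] using this
      exact ((hm.mul hs).mul (hden.div hg hG)).neg.add
        ((((hs.const_mul _)).sub ((htc0.mul (hm.mul (hs.pow 2))).const_mul _)).div_const _)
    have hlim : (-(μ * s₀ * (aeval n G * normalForm a' (p - n) / aeval n G))
          + ((1 + (a : ℂ) ^ 2) * s₀ - (1 + a * a') * (0 * (μ * s₀ ^ 2))) / (a - a'))
        = 3 / 2 * (1 + (a : ℂ) ^ 2) / (a - a') * s₀ := by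
      rw [hA', hμ]
      field_simp
      ring
    rw [hlim] at e1
    refine e1.congr' ?_
    have hg0 := hg.eventually_ne hG
    filter_upwards [htc, huv, hg0] with x hx hx' hgx0
    obtain ⟨hu0, hv0⟩ := hx'
    have h2 := normal_node' (q x) (c x) (hc x)
    have e2 : normalForm a (c x - n) = normalForm a (c x - q x)
        + ((1 + (a : ℂ) ^ 2) * lineVal a' b' (q x) - (1 + a * a') * lineVal a b (q x))
          / (a - a') := by
      have e3 : (a - a') * n 0 = b' - b := by
        simp only [lineVal] at hn hn'
        linear_combination hn' - hn
      have e4 : n 1 = a * n 0 + b := by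
        simp only [lineVal] at hn
        linear_combination hn
      simp only [normalForm, lineVal, Pi.sub_apply]
      rw [e4]
      field_simp
      linear_combination (-(1 : ℂ) - a ^ 2) * e3
    rw [e2]
    set M := (c x 0 - q x 0) * d1 G 1 (q x) - (c x 1 - q x 1) * d1 G 0 (q x)
    set N' := normalForm a' (c x - q x)
    have e5 : normalForm a (c x - q x) = -(lineVal a b (q x) * (aeval (q x) G * N'
        + lineVal a' b' (q x) * M)) / (lineVal a' b' (q x) * aeval (q x) G) := by
      rw [eq_div_iff (mul_ne_zero hv0 hgx0)]
      linear_combination h2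
    rw [e5]
    field_simp

end Node

/-! ### Compactness for the whole arrangement -/

section Arrangement

variable {d : ℕ} {a b : Fin d → ℝ}

/-- The product of the equations of all lines except the `i`-th and the `j`-th. -/
noncomputable def otherLines (a b : Fin d → ℝ) (i j : Fin d) : MvPolynomial (Fin 2) ℝ :=
  ∏ k ∈ (Finset.univ.erase i).erase j, lineEq (a k) (b k)

lemma lineArrangement_eq_mul (a b : Fin d → ℝ) (i : Fin d) :
    lineArrangement a b = lineEq (a i) (b i) * ∏ k ∈ Finset.univ.erase i, lineEq (a k) (b k) :=
  (Finset.mul_prod_erase _ _ (Finset.mem_univ i)).symm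

lemma lineArrangement_eq_mul_mul (a b : Fin d → ℝ) {i j : Fin d} (h : j ≠ i) :
    lineArrangement a b = lineEq (a i) (b i) * lineEq (a j) (b j) * otherLines a b i j := by
  rw [lineArrangement_eq_mul a b i, otherLines, mul_assoc,
    Finset.mul_prod_erase (Finset.univ.erase i) (fun k => lineEq (a k) (b k)) (a := j)
      (by simp [h])]

lemma d1_prod_lineEq (s : Finset (Fin d)) (k : Fin 2) (q : Fin 2 → ℂ) :
    d1 (∏ i ∈ s, lineEq (a i) (b i)) k q =
      ∑ i ∈ s, d1 (lineEq (a i) (b i)) k q * ∏ j ∈ s.erase i, lineVal (a j) (b j) q := by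
  induction s using Finset.induction_on with
  | empty => simp [d1]
  | insert x s hx ih =>
    rw [Finset.prod_insert hx, d1_mul, ih, Finset.sum_insert hx, Finset.erase_insert hx, map_prod,
      aeval_lineEq, Finset.mul_sum]
    simp only [aeval_lineEq]
    congr 1
    refine Finset.sum_congr rfl fun i hi => ?_
    have hix : i ≠ x := fun h => hx (h ▸ hi)
    rw [Finset.erase_insert_of_ne hix.symm, Finset.prod_insert (by simp [hx])]
    ring

/-- The normal equation expanded over all lines at once. In this form its leading terms at infinity
can be read off, which gives the boundedness of `q`. -/
lemma normal_lineArrangement (q : Fin 2 → ℂ) :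
    ∑ i, normalForm (a i) (curvatureCenter (lineArrangement a b) q - q) *
      ∏ j ∈ Finset.univ.erase i, lineVal (a j) (b j) q = 0 := by
  have h := center_normal (lineArrangement a b) q
  set c := curvatureCenter (lineArrangement a b) q
  rw [lineArrangement, d1_prod_lineEq, d1_prod_lineEq, Finset.mul_sum, Finset.mul_sum,
    ← Finset.sum_sub_distrib] at h
  rw [← h]
  refine Finset.sum_congr rfl fun i _ => ?_
  rw [d1_lineEq_zero, d1_lineEq_one, normalForm, Pi.sub_apply, Pi.sub_apply]
  ring

variable {α : Type*} {𝒰 : Ultrafilter α} {t : α → ℝ} {q : α → Fin 2 → ℂ} {p : Fin 2 → ℂ}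

/-- Points of the smoothings whose centres of curvature converge are bounded. -/
lemma exists_norm_le_of_tendsto_center (ha : Function.Injective a)
    (ht0 : Tendsto t 𝒰 (𝓝 0))
    (hP : ∀ᶠ x in 𝒰, aeval (q x) (lineArrangement a b) = (t x : ℂ) ^ 3)
    (hp : Tendsto (fun x => curvatureCenter (lineArrangement a b) (q x)) 𝒰 (𝓝 p)) :
    ∃ R, ∀ᶠ x in 𝒰, ‖q x‖ ≤ R := by
  by_contra! hcon
  have hN : Tendsto (fun x => ‖q x‖) 𝒰 atTop := by
    refine tendsto_atTop.2 fun R => ?_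
    exact (hcon R).mono fun x hx => hx.le
  have hN0 : ∀ᶠ x in 𝒰, ‖q x‖ ≠ 0 := hN.eventually_ne_atTop 0
  have hNi : Tendsto (fun x => ((‖q x‖⁻¹ : ℝ) : ℂ)) 𝒰 (𝓝 0) := by
    have := (Complex.continuous_ofReal.tendsto 0).comp (tendsto_inv_atTop_zero.comp hN)
    simpa [Function.comp_def] using this
  have hnorm : ∀ᶠ x in 𝒰, ‖((‖q x‖⁻¹ : ℝ) : ℂ) • q x‖ = 1 := by
    filter_upwards [hN0] with x hx
    rw [norm_smul, Complex.norm_real, norm_inv, norm_norm, inv_mul_cancel₀ hx]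
  obtain ⟨e, he⟩ := exists_ultrafilter_tendsto 𝒰
    (fun x => ((‖q x‖⁻¹ : ℝ) : ℂ) • q x) 1 (hnorm.mono fun x hx => hx.le)
  have he1 : ‖e‖ = 1 :=
    tendsto_nhds_unique he.norm (tendsto_const_nhds.congr' (hnorm.mono fun x hx => hx.symm))
  have hei : ∀ i, Tendsto (fun x => ((‖q x‖⁻¹ : ℝ) : ℂ) * q x i) 𝒰 (𝓝 (e i)) :=
    fun i => tendsto_pi_nhds.1 he i
  have hL : ∀ i, Tendsto (fun x => ((‖q x‖⁻¹ : ℝ) : ℂ) * lineVal (a i) (b i) (q x)) 𝒰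
      (𝓝 (e 1 - a i * e 0)) := by
    intro i
    have := ((hei 1).sub ((hei 0).const_mul (a i : ℂ))).sub (hNi.mul_const (b i : ℂ))
    rw [zero_mul, sub_zero] at this
    refine this.congr fun x => ?_
    simp only [lineVal]
    ring
  have htc0 : Tendsto (fun x => (t x : ℂ)) 𝒰 (𝓝 0) := by
    have := (Complex.continuous_ofReal.tendsto 0).comp ht0
    simpa [Function.comp_def] using this
  -- The limit direction `e` of an unbounded `q` is a zero of the leading form of the arrangement,
  -- hence the direction of some line.
  have hprod : ∏ i, (e 1 - a i * e 0) = 0 := by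
    have h1 := tendsto_finsetProd (Finset.univ : Finset (Fin d)) fun i _ => hL i
    have h2 : Tendsto (fun x => ((‖q x‖⁻¹ : ℝ) : ℂ) ^ d * (t x : ℂ) ^ 3) 𝒰 (𝓝 (0 ^ d * 0 ^ 3)) :=
      (hNi.pow d).mul (htc0.pow 3)
    rw [zero_pow (by norm_num : 3 ≠ 0), mul_zero] at h2
    refine tendsto_nhds_unique (h1.congr' ?_) h2
    filter_upwards [hP] with x hx
    rw [Finset.prod_mul_distrib, Finset.prod_const, ← hx, lineArrangement, map_prod]
    simp [aeval_lineEq]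
  obtain ⟨i, -, hi⟩ := Finset.prod_eq_zero_iff.1 hprod
  have he1' : e 1 = a i * e 0 := sub_eq_zero.1 hi
  have he0 : e 0 ≠ 0 := by
    intro h0
    have : e = 0 := by
      ext k
      fin_cases k
      · exact h0
      · simp [he1', h0]
    simp [this] at he1
  have hNF : ∀ i, Tendsto (fun x => ((‖q x‖⁻¹ : ℝ) : ℂ) *
      normalForm (a i) (curvatureCenter (lineArrangement a b) (q x) - q x)) 𝒰
      (𝓝 (-(e 0 + a i * e 1))) := by
    intro i
    have hc0 := hNi.mul (tendsto_pi_nhds.1 hp 0)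
    have hc1 := hNi.mul (tendsto_pi_nhds.1 hp 1)
    have := (hc0.sub (hei 0)).add ((hc1.sub (hei 1)).const_mul (a i : ℂ))
    refine (this.congr fun x => ?_).trans_eq ?_
    · simp only [normalForm, Pi.sub_apply]
      ring
    · congr 1
      ring
  -- The leading part of the normal equation. Only the term of the line with direction `e` survives,
  -- and it is nonzero because the slopes are distinct and `1 + a i ^ 2 ≠ 0`.
  have hsum : ∑ k, -(e 0 + a k * e 1) * ∏ j ∈ Finset.univ.erase k, (e 1 - a j * e 0) = 0 := by
    have h1 := tendsto_finsetSum (Finset.univ : Finset (Fin d)) fun k _ =>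
      (hNF k).mul (tendsto_finsetProd (Finset.univ.erase k) fun j _ => hL j)
    refine tendsto_nhds_unique (h1.congr fun x => ?_) tendsto_const_nhds
    have h2 := normal_lineArrangement (a := a) (b := b) (q x)
    rw [← mul_zero ((((‖q x‖⁻¹ : ℝ) : ℂ) * ((‖q x‖⁻¹ : ℝ) : ℂ) ^ (d - 1))), ← h2, Finset.mul_sum]
    refine Finset.sum_congr rfl fun k _ => ?_
    rw [Finset.prod_mul_distrib, Finset.prod_const, Finset.card_erase_of_mem (Finset.mem_univ k),
      Finset.card_univ, Fintype.card_fin]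
    ring
  rw [Finset.sum_eq_single i] at hsum
  · rcases mul_eq_zero.1 hsum with h | h
    · have h3 : (1 + (a i : ℂ) ^ 2) * e 0 = 0 := by
        rw [he1'] at h
        linear_combination -h
      have h4 : (1 + (a i : ℂ) ^ 2) ≠ 0 := by
        have : (1 + a i ^ 2) ≠ 0 := by positivity
        exact_mod_cast this
      exact mul_ne_zero h4 he0 h3
    · obtain ⟨j, hj, h⟩ := Finset.prod_eq_zero_iff.1 h
      have h3 : ((a i : ℂ) - a j) * e 0 = 0 := by
        rw [he1'] at h
        linear_combination h
      rcases mul_eq_zero.1 h3 with h | h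
      · exact (Finset.ne_of_mem_erase hj) (ha (by exact_mod_cast (sub_eq_zero.1 h).symm))
      · exact he0 h
  · intro k _ hk
    rw [Finset.prod_eq_zero (i := i) (by simp [hk.symm]) hi, mul_zero]
  · simp

/-- A limit of points of the smoothings whose centres of curvature converge is a node. -/
lemma exists_lineVal_eq_zero_of_tendsto {n : Fin 2 → ℂ}
    (ht0 : Tendsto t 𝒰 (𝓝 0))
    (hP : ∀ᶠ x in 𝒰, aeval (q x) (lineArrangement a b) = (t x : ℂ) ^ 3)
    (hκ : ∀ᶠ x in 𝒰, curvatureForm (lineArrangement a b) (q x) ≠ 0)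
    (hq : Tendsto q 𝒰 (𝓝 n))
    (hp : Tendsto (fun x => curvatureCenter (lineArrangement a b) (q x)) 𝒰 (𝓝 p)) :
    ∃ i j, j ≠ i ∧ lineVal (a i) (b i) n = 0 ∧ lineVal (a j) (b j) n = 0 := by
  have htc0 : Tendsto (fun x => (t x : ℂ) ^ 3) 𝒰 (𝓝 0) := by
    have := ((Complex.continuous_ofReal.pow 3).tendsto 0).comp ht0
    simpa [Function.comp_def] using this
  have h0 : aeval n (lineArrangement a b) = 0 := by
    have h1 := ((continuous_aeval_real (lineArrangement a b)).tendsto n).comp hq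
    exact tendsto_nhds_unique (h1.congr' hP) htc0
  have h1 := h0
  rw [lineArrangement, map_prod] at h1
  obtain ⟨i, -, hi⟩ := Finset.prod_eq_zero_iff.1 h1
  rw [aeval_lineEq] at hi
  refine ⟨i, ?_⟩
  have hκn : curvatureForm (lineArrangement a b) n = 0 := by
    rw [lineArrangement_eq_mul a b i]
    exact curvatureForm_lineEq_mul _ _ _ _ hi
  have hκt := ((continuous_curvatureForm (lineArrangement a b)).tendsto n).comp hq
  have hdt := fun k => ((continuous_d1 (lineArrangement a b) k).tendsto n).comp hq
  simp only [Function.comp_def] at hκt hdt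
  rw [hκn] at hκt
  -- The centres converge while the curvature form tends to zero, so the numerator must vanish at
  -- `n`. On line `i` the gradient is `(-a i, 1)` times the product `Q` of the other equations, and
  -- a real direction is not isotropic, so `Q = 0`.
  have key : d1 (lineArrangement a b) 1 n *
      (d1 (lineArrangement a b) 0 n ^ 2 + d1 (lineArrangement a b) 1 n ^ 2) = 0 := by
    have h2 := ((tendsto_pi_nhds.1 hp 1).sub (tendsto_pi_nhds.1 hq 1)).mul hκt
    rw [mul_zero] at h2
    refine tendsto_nhds_unique ((hdt 1).mul (((hdt 0).pow 2).add ((hdt 1).pow 2))) (h2.congr' ?_)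
    filter_upwards [hκ] with x hx using center_sub_mul _ _ hx 1
  rw [lineArrangement_eq_mul a b i, d1_mul, d1_mul, d1_lineEq_zero, d1_lineEq_one, aeval_lineEq, hi,
    map_prod] at key
  set Q := ∏ k ∈ Finset.univ.erase i, aeval n (lineEq (a k) (b k)) with hQ
  have h4 : (1 + (a i : ℂ) ^ 2) ≠ 0 := by
    have : (1 + a i ^ 2) ≠ 0 := by positivity
    exact_mod_cast this
  have h5 : Q ^ 3 * (1 + (a i : ℂ) ^ 2) = 0 := by linear_combination key
  have h6 : Q = 0 := by simpa [h4] using h5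
  obtain ⟨j, hj, hj0⟩ := Finset.prod_eq_zero_iff.1 h6
  rw [aeval_lineEq] at hj0
  exact ⟨j, Finset.ne_of_mem_erase hj, hi, hj0⟩

lemma eq_node_of_lineVal {a b a' b' : ℝ} (h : a ≠ a') {n : Fin 2 → ℂ} (h₁ : lineVal a b n = 0)
    (h₂ : lineVal a' b' n = 0) : n = toComplex (node a b a' b') := by
  rw [← blowPoint_zero b b' 0 0]
  exact (blowPoint_of_lineVal b b' h (by simpa using h₁) (by simpa using h₂)).symm

lemma GeneralPosition.aeval_otherLines_ne_zero (h : GeneralPosition a b) {i j : Fin d}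
    (hij : j ≠ i) :
    aeval (toComplex (node (a i) (b i) (a j) (b j))) (otherLines a b i j) ≠ 0 := by
  rw [otherLines, map_prod, Finset.prod_ne_zero_iff]
  intro k hk h0
  simp only [Finset.mem_erase, Finset.mem_univ, and_true] at hk
  have hik : a i ≠ a k := fun he => hk.2 (h.slope_injective he).symm
  rw [aeval_lineEq] at h0
  have := eq_node_of_lineVal hik (lineVal_node_left (b i) (b j)) h0
  have h2 := congrFun this 0
  simp only [toComplex, node, Matrix.cons_val_zero, Complex.ofReal_inj] at h2
  exact h.node_ne i j k hij hk.2 (Ne.symm hk.1) h2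

end Arrangement

/-! ### The unique real branch at a normal -/

lemma exists_cube_root (x : ℝ) : ∃ y : ℝ, y ^ 3 = x := by
  rcases le_total 0 x with h | h
  · refine ⟨x ^ ((3 : ℕ) : ℝ)⁻¹, Real.rpow_inv_natCast_pow h (by norm_num)⟩
  · refine ⟨-(-x) ^ ((3 : ℕ) : ℝ)⁻¹, ?_⟩
    rw [Odd.neg_pow (by decide), Real.rpow_inv_natCast_pow (by linarith) (by norm_num), neg_neg]

section Uniform

variable {d : ℕ} {a b : Fin d → ℝ}

/-- `φ (·, t)` is the branch of the evolute of `f - t ^ 3` which tends, as `t → 0`, to the line of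
inverse slope `-m` through `p`: near `p` its graph consists of centres of curvature, and contains
the centres of curvature of all points near `n` which are sufficiently close to real points. -/
structure IsNormalBranch (f : MvPolynomial (Fin 2) ℝ) (m : ℝ) (n p : Fin 2 → ℝ) (φ : ℂ × ℂ → ℂ) :
    Prop where
  analyticAt : AnalyticAt ℂ φ (p 1, 0)
  eq_line : ∀ᶠ y : ℂ in 𝓝 (p 1 : ℂ), φ (y, 0) = p 0 - m * (y - p 1)
  real : ∀ᶠ x : ℝ × ℝ in 𝓝 (p 1, 0), (φ (x.1, x.2)).im = 0
  exists_center : ∀ᶠ x : ℂ × ℂ in 𝓝 ((p 1 : ℂ), (0 : ℂ)), x.2 ≠ 0 → ∃ q : Fin 2 → ℂ,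
    aeval q f = x.2 ^ 3 ∧ curvatureForm f q ≠ 0 ∧ curvatureCenter f q = ![φ x, x.1]
  center_mem : ∀ {α : Type} (𝒰 : Ultrafilter α) (t : α → ℝ) (q : α → Fin 2 → ℂ)
    (r : α → Fin 2 → ℝ), Tendsto t 𝒰 (𝓝 0) → (∀ᶠ x in 𝒰, t x ≠ 0) →
    (∀ᶠ x in 𝒰, aeval (q x) f = (t x : ℂ) ^ 3) → (∀ᶠ x in 𝒰, curvatureForm f (q x) ≠ 0) →
    Tendsto q 𝒰 (𝓝 (toComplex n)) →
    Tendsto (fun x => curvatureCenter f (q x)) 𝒰 (𝓝 (toComplex p)) →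
    (∀ k, Tendsto (fun x => (curvatureCenter f (q x) k - r x k) / t x) 𝒰 (𝓝 0)) →
    ∀ᶠ x in 𝒰, curvatureCenter f (q x) 0 = φ (curvatureCenter f (q x) 1, t x)

/-- The point `p` fixes `s ^ 2 / w`, so `w = μ * s ^ 2`, and `s * w * g = 1` becomes `s ^ 3 = (μ *
g)⁻¹`. Its real root gives the branch; centres within `o(t)` of real points have real limit `s` and
so lie on this branch. -/
lemma GeneralPosition.exists_isNormalBranch (h : GeneralPosition a b) {i j : Fin d} (hij : j ≠ i)
    {p : Fin 2 → ℝ} (hp : p 0 + a i * p 1 = normalConst (a i) (b i) (a j) (b j))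
    (hpn : p ≠ node (a i) (b i) (a j) (b j)) :
    ∃ φ, IsNormalBranch (lineArrangement a b) (a i) (node (a i) (b i) (a j) (b j)) p φ := by
  have haij : a i ≠ a j := fun he => hij (h.slope_injective he).symm
  have hne : a i - a j ≠ 0 := sub_ne_zero.2 haij
  have hnec : (a i : ℂ) - a j ≠ 0 := by exact_mod_cast hne
  have hG := h.aeval_otherLines_ne_zero hij
  have hfac := lineArrangement_eq_mul_mul a b hij
  set G := otherLines a b i j with hGdef
  set n := node (a i) (b i) (a j) (b j) with hn
  obtain ⟨g, hg⟩ : ∃ g : ℝ, aeval (toComplex n) G = (g : ℂ) := by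
    refine ⟨(aeval (toComplex n) G).re, ?_⟩
    have := aeval_conj G (toComplex n)
    rw [show (fun i => (starRingEnd ℂ) (toComplex n i)) = toComplex n from
      funext fun i => Complex.conj_ofReal _] at this
    exact (Complex.conj_eq_iff_re.1 this.symm).symm
  have hg0 : g ≠ 0 := by
    rintro rfl
    exact hG (by simpa using hg)
  have hpar : p 0 - n 0 = -(a i * (p 1 - n 1)) := by
    have : n 0 + a i * n 1 = normalConst (a i) (b i) (a j) (b j) := by
      simp [hn, node, normalConst]
    linear_combination hp - this
  have hy : p 1 - n 1 ≠ 0 := by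
    intro h0
    rw [h0, mul_zero, neg_zero] at hpar
    apply hpn
    ext k
    fin_cases k
    · exact sub_eq_zero.1 hpar
    · exact sub_eq_zero.1 h0
  have ha : 1 + a i ^ 2 ≠ 0 := by positivity
  set μ : ℝ := (1 + a i ^ 2) / (2 * (a i - a j) ^ 2 * (p 1 - n 1)) with hμ
  have hμ0 : μ ≠ 0 := div_ne_zero ha (by simp [hne, hy])
  obtain ⟨s, hs3⟩ := exists_cube_root (μ * g)⁻¹
  have hs0 : s ≠ 0 := by
    rintro rfl
    rw [zero_pow (by norm_num)] at hs3
    exact inv_ne_zero (mul_ne_zero hμ0 hg0) hs3.symm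
  have hw0 : μ * s ^ 2 ≠ 0 := mul_ne_zero hμ0 (pow_ne_zero 2 hs0)
  have hE : (s : ℂ) * (μ * s ^ 2 : ℝ) * aeval (toComplex n) G = 1 := by
    rw [hg]
    have : s * (μ * s ^ 2) * g = 1 := by
      rw [show s * (μ * s ^ 2) * g = s ^ 3 * (μ * g) by ring, hs3,
        inv_mul_cancel₀ (mul_ne_zero hμ0 hg0)]
    exact_mod_cast this
  have hp1 : n 1 + (1 + a i ^ 2) * s ^ 2 / (2 * (a i - a j) ^ 2 * (μ * s ^ 2)) = p 1 := by
    rw [hμ]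
    field_simp
    ring
  obtain ⟨φ, h1, h2, h3, h4, h5⟩ := exists_branch (b i) (b j) G haij hG hw0 hs0 hE hp1
  rw [← hfac] at h4
  refine ⟨φ, h1, ?_, h3, h4, ?_⟩
  · filter_upwards [h2] with y hy
    rw [hy]
    have : ((p 0 - n 0 : ℝ) : ℂ) = ((-(a i * (p 1 - n 1)) : ℝ) : ℂ) := by rw [hpar]
    push_cast at this
    linear_combination -this
  · intro α 𝒰 t q r ht0 ht hP hκ hq hc hr
    have hpnc : toComplex p ≠ toComplex n := by
      intro he
      apply hpn
      ext k
      exact Complex.ofReal_injective (congrFun he k)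
    have hA : normalForm (a i) (toComplex p - toComplex n) = 0 := by
      have : ((p 0 - n 0 : ℝ) : ℂ) = ((-(a i * (p 1 - n 1)) : ℝ) : ℂ) := by rw [hpar]
      push_cast at this
      simp only [normalForm, Pi.sub_apply, toComplex]
      linear_combination this
    obtain ⟨w', s', w₀, s₀, hw', hs', hws, hE', hp', hX⟩ := exists_tendsto_blow haij
      (lineVal_node_left (b i) (b j)) (lineVal_node_right (b i) (b j) haij) hG
      (c := fun x => curvatureCenter (lineArrangement a b) (q x)) (t := t)
      (fun x => by rw [← hfac]) (by rwa [← hfac]) ht ht0 (by rwa [← hfac]) hq hc hpnc hA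
    -- the limit `s₀` is real
    have hXr : Tendsto (fun x => normalForm (a i) (toComplex (r x) - toComplex n) / t x) 𝒰
        (𝓝 (3 / 2 * (1 + (a i : ℂ) ^ 2) / (a i - a j) * s₀)) := by
      have := hX.sub ((hr 0).add ((hr 1).const_mul (a i : ℂ)))
      rw [mul_zero, add_zero, sub_zero] at this
      refine this.congr fun x => ?_
      simp only [normalForm, Pi.sub_apply, toComplex]
      ring
    -- Replacing the centres by the real points `r` does not change the limit at scale `t`, and the
    -- quotients are then real. This discards the two non-real cube roots.
    have him : (3 / 2 * (1 + (a i : ℂ) ^ 2) / (a i - a j) * s₀).im = 0 := by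
      refine tendsto_nhds_unique ((Complex.continuous_im.tendsto _).comp hXr)
        (tendsto_const_nhds.congr fun x => ?_)
      simp only [Function.comp_apply, normalForm, Pi.sub_apply, toComplex]
      rw [← Complex.ofReal_im ((r x 0 - n 0 + a i * (r x 1 - n 1)) / t x)]
      push_cast
      rfl
    have hs0r : ∃ σ : ℝ, s₀ = σ := by
      refine ⟨s₀.re, ?_⟩
      have h6 : (3 / 2 * (1 + (a i : ℂ) ^ 2) / (a i - a j) * s₀).im =
          3 / 2 * (1 + a i ^ 2) / (a i - a j) * s₀.im := by
        rw [← Complex.im_ofReal_mul]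
        push_cast
        rfl
      rw [h6] at him
      have h7 : s₀.im = 0 := by
        rcases mul_eq_zero.1 him with h | h
        · exfalso
          exact div_ne_zero (mul_ne_zero (by norm_num) ha) hne h
        · exact h
      exact Complex.ext (by simp) (by simp [h7])
    obtain ⟨σ, rfl⟩ := hs0r
    have hw0ne : w₀ ≠ 0 := by
      rintro rfl
      simp at hE'
    have hw₀ : w₀ = ((μ * σ ^ 2 : ℝ) : ℂ) := by
      have hyc : ((p 1 : ℝ) : ℂ) - (n 1 : ℝ) ≠ 0 := by exact_mod_cast hy
      simp only [toComplex] at hp'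
      rw [hμ]
      push_cast
      rw [← hp']
      have h8 : (1 + (a i : ℂ) ^ 2) ≠ 0 := by exact_mod_cast ha
      have h9 : (σ : ℂ) ≠ 0 := by
        intro h0
        simp [h0] at hE'
      field_simp
    have hσ : σ = s := by
      rw [hw₀, hg] at hE'
      have h10 : σ * (μ * σ ^ 2) * g = 1 := by exact_mod_cast hE'
      apply (Odd.strictMono_pow (by decide : Odd 3)).injective
      simp only
      rw [hs3]
      refine eq_inv_of_mul_eq_one_left ?_
      linear_combination h10
    subst hσ
    rw [hw₀] at hw'
    have htc0 : Tendsto (fun x => (t x : ℂ)) 𝒰 (𝓝 0) := by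
      have := (Complex.continuous_ofReal.tendsto 0).comp ht0
      simpa [Function.comp_def] using this
    have hlim : Tendsto (fun x => (w' x, s' x, (t x : ℂ))) 𝒰
        (𝓝 (((μ * σ ^ 2 : ℝ) : ℂ), (σ : ℂ), (0 : ℂ))) := hw'.prodMk_nhds (hs'.prodMk_nhds htc0)
    filter_upwards [hlim.eventually h5, hws, ht, hP] with x h6 h7 h8 h9
    have htx : (t x : ℂ) ≠ 0 := by exact_mod_cast h8
    have hq' : blowPoint (a i) (b i) (a j) (b j) (w' x, s' x, (t x : ℂ)) = q x :=
      blowPoint_of_lineVal (b i) (b j) haij h7.1 h7.2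
    have hc' := curvatureCenter_blowPoint (b i) (b j) G haij (x := (w' x, s' x, (t x : ℂ))) htx
    have hE'' := aeval_blowPoint (b i) (b j) G haij (w' x, s' x, (t x : ℂ))
    rw [hq', ← hfac] at hc' hE''
    rw [hc']
    refine h6 ?_
    rw [h9] at hE''
    exact mul_left_cancel₀ (pow_ne_zero 3 htx) (by rw [mul_one]; exact hE''.symm)

end Uniform

/-! ### From two branches to a crunode -/

/-- Two transverse real analytic graphs through a real point form a crunode. -/
lemma isCrunode_of_graphs {S : Set (Fin 2 → ℂ)} {p : Fin 2 → ℝ} {ψ : Fin 2 → ℂ → ℂ}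
    (hψ : ∀ m, AnalyticAt ℂ (ψ m) (p 1)) (hr : ∀ m, ∀ᶠ y : ℝ in 𝓝 (p 1), (ψ m y).im = 0)
    (hp : ∀ m, ψ m (p 1) = p 0) (hd : deriv (ψ 0) (p 1) ≠ deriv (ψ 1) (p 1))
    (hS : ∀ᶠ z in 𝓝 (toComplex p), z ∈ S ↔ z 0 = ψ 0 (z 1) ∨ z 0 = ψ 1 (z 1)) :
    IsCrunode S p := by
  have hdf : ∀ m, HasFDerivAt (fun z : Fin 2 → ℂ => z 0 - ψ m (z 1))
      (ContinuousLinearMap.proj (R := ℂ) (φ := fun _ : Fin 2 => ℂ) 0 - deriv (ψ m) (p 1) •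
        ContinuousLinearMap.proj (R := ℂ) (φ := fun _ : Fin 2 => ℂ) 1) (toComplex p) := by
    intro m
    have h1 : HasFDerivAt (fun z : Fin 2 → ℂ => z 1)
        (ContinuousLinearMap.proj (R := ℂ) (φ := fun _ : Fin 2 => ℂ) 1) (toComplex p) :=
      (ContinuousLinearMap.proj (R := ℂ) (φ := fun _ : Fin 2 => ℂ) 1).hasFDerivAt
    have h0 : HasFDerivAt (fun z : Fin 2 → ℂ => z 0)
        (ContinuousLinearMap.proj (R := ℂ) (φ := fun _ : Fin 2 => ℂ) 0) (toComplex p) :=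
      (ContinuousLinearMap.proj (R := ℂ) (φ := fun _ : Fin 2 => ℂ) 0).hasFDerivAt
    exact h0.sub (HasDerivAt.comp_hasFDerivAt (toComplex p)
      (hψ m).differentiableAt.hasDerivAt h1)
  have hbr : ∀ m, IsSmoothRealBranch (fun z => z 0 - ψ m (z 1)) p := by
    intro m
    refine ⟨?_, ?_, ?_, ?_⟩
    · have h0 : AnalyticAt ℂ (fun z : Fin 2 → ℂ => z 0) (toComplex p) :=
        (ContinuousLinearMap.proj (R := ℂ) (φ := fun _ : Fin 2 => ℂ) 0).analyticAt _
      have h1 : AnalyticAt ℂ (fun z : Fin 2 → ℂ => z 1) (toComplex p) :=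
        (ContinuousLinearMap.proj (R := ℂ) (φ := fun _ : Fin 2 => ℂ) 1).analyticAt _
      exact h0.sub (AnalyticAt.fun_comp (g := ψ m) (hψ m) h1)
    · have hc : Tendsto (fun x : Fin 2 → ℝ => x 1) (𝓝 p) (𝓝 (p 1)) :=
        (continuous_apply 1).tendsto p
      filter_upwards [hc.eventually (hr m)] with x hx
      simp [toComplex, hx]
    · simp [toComplex, hp]
    · rw [(hdf m).fderiv]
      intro h
      have := congrArg (fun L : (Fin 2 → ℂ) →L[ℂ] ℂ => L ![1, 0]) h
      simp at this
  refine ⟨_, _, hbr 0, hbr 1, ?_, ?_⟩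
  · rw [(hdf 0).fderiv, (hdf 1).fderiv, LinearIndependent.pair_iff]
    intro s t hst
    have h0 := congrArg (fun L : (Fin 2 → ℂ) →L[ℂ] ℂ => L ![1, 0]) hst
    have h1 := congrArg (fun L : (Fin 2 → ℂ) →L[ℂ] ℂ => L ![0, 1]) hst
    simp at h0 h1
    have h2 : s * (deriv (ψ 0) (p 1) - deriv (ψ 1) (p 1)) = 0 := by
      linear_combination -h1 - deriv (ψ 1) (p 1) * h0
    have h3 : s = 0 := by simpa [sub_ne_zero.2 hd] using h2
    exact ⟨h3, by simpa [h3] using h0⟩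
  · filter_upwards [hS] with z hz
    rw [hz, sub_eq_zero, sub_eq_zero]

/-- Persistence of a transversal zero of a continuous family of real functions. -/
lemma eventually_exists_zero {ψ : ℝ × ℝ → ℝ} {y₀ m : ℝ} (hm : m ≠ 0)
    (hc : ∀ᶠ x in 𝓝 (y₀, (0 : ℝ)), ContinuousAt ψ x)
    (h0 : ∀ᶠ y in 𝓝 y₀, ψ (y, 0) = m * (y - y₀)) {Q : ℝ × ℝ → Prop}
    (hQ : ∀ᶠ x in 𝓝 (y₀, (0 : ℝ)), Q x) :
    ∀ᶠ t in 𝓝 (0 : ℝ), ∃ y, Q (y, t) ∧ ψ (y, t) = 0 := by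
  obtain ⟨ε, hε, hball⟩ := Metric.eventually_nhds_iff.1 (hc.and hQ)
  obtain ⟨ε', hε', hball'⟩ := Metric.eventually_nhds_iff.1 h0
  set η := min ε ε' / 2 with hη
  have hη0 : 0 < η := by positivity
  have hηε : η < ε := by have := min_le_left ε ε'; linarith
  have hηε' : η < ε' := by have := min_le_right ε ε'; linarith
  have hin : ∀ y t, |y - y₀| ≤ η → |t| ≤ η → ContinuousAt ψ (y, t) ∧ Q (y, t) := by
    intro y t hy ht
    apply hball
    rw [Prod.dist_eq, max_lt_iff, Real.dist_eq, Real.dist_eq]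
    simp only [sub_zero]
    exact ⟨by linarith, by linarith⟩
  -- Multiplication by `m` fixes the signs at the two ends whatever the sign of `m`; the signs
  -- persist for small `t`.
  have hplus : 0 < m * ψ (y₀ + η, 0) := by
    rw [hball' (by rw [Real.dist_eq]; simp [abs_of_pos hη0, hηε'])]
    have : 0 < m ^ 2 := by positivity
    nlinarith
  have hminus : m * ψ (y₀ - η, 0) < 0 := by
    rw [hball' (by rw [Real.dist_eq]; simp [abs_of_pos hη0, hηε'])]
    have : 0 < m ^ 2 := by positivity
    nlinarith
  have hcont : ∀ y, |y - y₀| ≤ η → ContinuousAt (fun t => m * ψ (y, t)) 0 := by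
    intro y hy
    have h1 := (hin y 0 hy (by simp [hη0.le])).1
    have h2 : ContinuousAt (fun t : ℝ => (y, t)) 0 := by fun_prop
    exact (ContinuousAt.comp' (g := ψ) h1 h2).const_mul m
  have e1 := (hcont (y₀ + η) (by simp [abs_of_pos hη0])).eventually_const_lt hplus
  have e2 := (hcont (y₀ - η) (by simp [abs_of_pos hη0])).eventually_lt_const hminus
  have e3 : ∀ᶠ t in 𝓝 (0 : ℝ), |t| ≤ η := by
    filter_upwards [Metric.ball_mem_nhds (0 : ℝ) hη0] with t ht
    simpa using (Metric.mem_ball.1 ht).le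
  filter_upwards [e1, e2, e3] with t h1 h2 h3
  have habs : ∀ y ∈ Set.Icc (y₀ - η) (y₀ + η), |y - y₀| ≤ η := fun y hy =>
    abs_le.2 ⟨by linarith [hy.1], by linarith [hy.2]⟩
  have hco : ContinuousOn (fun y => m * ψ (y, t)) (Set.Icc (y₀ - η) (y₀ + η)) := by
    intro y hy
    have k1 := (hin y t (habs y hy) h3).1
    have k2 : ContinuousAt (fun y : ℝ => (y, t)) y := by fun_prop
    exact ((ContinuousAt.comp' (g := ψ) (f := fun y : ℝ => (y, t)) k1 k2).const_mul
      m).continuousWithinAt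
  obtain ⟨y, hy, hy0⟩ := intermediate_value_Icc (by linarith) hco ⟨h2.le, h1.le⟩
  refine ⟨y, (hin y t (habs y hy) h3).2, ?_⟩
  simpa [hm] using hy0

lemma hasDerivAt_slice {φ : ℂ × ℂ → ℂ} {y t : ℂ} (h : AnalyticAt ℂ φ (y, t)) :
    HasDerivAt (fun y => φ (y, t)) (fderiv ℂ φ (y, t) (1, 0)) y := by
  have h1 : HasDerivAt (fun y : ℂ => (y, t)) ((1 : ℂ), (0 : ℂ)) y :=
    (hasDerivAt_id y).prodMk (hasDerivAt_const y t)
  exact HasFDerivAt.comp_hasDerivAt y h.differentiableAt.hasFDerivAt h1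

section Crossing

variable {d : ℕ} {a b : Fin d → ℝ} {i k j l : Fin d} {p : Fin 2 → ℝ}

lemma node_comm {a b a' b' : ℝ} (h : a ≠ a') : node a b a' b' = node a' b' a b := by
  have h1 : a - a' ≠ 0 := sub_ne_zero.2 h
  have h2 : a' - a ≠ 0 := sub_ne_zero.2 h.symm
  have h3 : nodeX a b a' b' = nodeX a' b' a b := by
    unfold nodeX
    rw [div_eq_div_iff h1 h2]
    ring
  have h4 : nodeX a b a' b' * (a - a') = b' - b := by
    unfold nodeX
    field_simp
  unfold node
  rw [← h3]
  congr 2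
  linear_combination h4

lemma node_mem_normal (a b a' b' : ℝ) :
    node a b a' b' 0 + a * node a b a' b' 1 = normalConst a b a' b' := by
  simp [node, normalConst]

/-- Both normals at a node pass through it, so `(r, s)` and `(s, r)` would both belong to `{(i, j),
(k, l)}`, against the conditions on the indices. -/
lemma GeneralPosition.ne_node (h : GeneralPosition a b) (hik : i ≠ k)
    (hji : j ≠ i) (hjk : j ≠ k) (hli : l ≠ i) (hlk : l ≠ k)
    (hp₁ : p 0 + a i * p 1 = normalConst (a i) (b i) (a j) (b j))
    (hp₂ : p 0 + a k * p 1 = normalConst (a k) (b k) (a l) (b l)) {r s : Fin d} (hsr : s ≠ r) :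
    p ≠ node (a r) (b r) (a s) (b s) := by
  intro he
  have h1 := h.eq_of_mem_normal hik hji hjk hli hlk hp₁ hp₂ hsr (by rw [he, node_mem_normal])
  have h2 := h.eq_of_mem_normal hik hji hjk hli hlk hp₁ hp₂ hsr.symm (by
    rw [he, node_comm (fun h' => hsr (h.slope_injective h').symm), node_mem_normal])
  grind

/-- Near the common point of two normals every centre of curvature of a smoothing lies on one of
the two corresponding branches. -/
lemma GeneralPosition.eventually_center_mem (h : GeneralPosition a b) (hik : i ≠ k)
    (hji : j ≠ i) (hjk : j ≠ k) (hli : l ≠ i) (hlk : l ≠ k)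
    (hp₁ : p 0 + a i * p 1 = normalConst (a i) (b i) (a j) (b j))
    (hp₂ : p 0 + a k * p 1 = normalConst (a k) (b k) (a l) (b l)) {φ : Fin 2 → ℂ × ℂ → ℂ}
    (hφ₀ : IsNormalBranch (lineArrangement a b) (a i) (node (a i) (b i) (a j) (b j)) p (φ 0))
    (hφ₁ : IsNormalBranch (lineArrangement a b) (a k) (node (a k) (b k) (a l) (b l)) p (φ 1)) :
    ∀ᶠ x : ℝ × (Fin 2 → ℝ) in 𝓝[>] 0 ×ˢ 𝓝 p, ∀ q : Fin 2 → ℂ,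
      aeval q (lineArrangement a b) = (x.1 : ℂ) ^ 3 → curvatureForm (lineArrangement a b) q ≠ 0 →
      (∀ m, ‖curvatureCenter (lineArrangement a b) q m - x.2 m‖ ≤ x.1 ^ 2) →
      ∃ m, curvatureCenter (lineArrangement a b) q 0 =
        φ m (curvatureCenter (lineArrangement a b) q 1, x.1) := by
  set f := lineArrangement a b with hf
  by_contra hcon
  set Bad : Set ((ℝ × (Fin 2 → ℝ)) × (Fin 2 → ℂ)) := {y | aeval y.2 f = (y.1.1 : ℂ) ^ 3 ∧
    curvatureForm f y.2 ≠ 0 ∧ (∀ m, ‖curvatureCenter f y.2 m - y.1.2 m‖ ≤ y.1.1 ^ 2) ∧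
    ¬ ∃ m, curvatureCenter f y.2 0 = φ m (curvatureCenter f y.2 1, y.1.1)} with hBad
  set L : Filter (ℝ × (Fin 2 → ℝ)) := 𝓝[>] 0 ×ˢ 𝓝 p with hL
  -- If the claim fails, the counterexamples `((t, r), q)` carry an ultrafilter along which `t → 0`
  -- and `r → p`; all limits below are taken along it.
  have hne : (Filter.comap Prod.fst L ⊓ 𝓟 Bad).NeBot := by
    rw [inf_principal_neBot_iff]
    rintro U ⟨V, hV, hVU⟩
    have hfr : ∃ᶠ x in L, ∃ q, (x, q) ∈ Bad := by
      refine fun hev => hcon (hev.mono fun x hx q h1 h2 h3 => ?_)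
      by_contra h4
      exact hx ⟨q, h1, h2, h3, h4⟩
    obtain ⟨x, ⟨q, hq⟩, hxV⟩ := (hfr.and_eventually hV).exists
    exact ⟨(x, q), hVU hxV, hq⟩
  set 𝒰 := Ultrafilter.of (Filter.comap Prod.fst L ⊓ 𝓟 Bad) with h𝒰
  have hle : (𝒰 : Filter _) ≤ Filter.comap Prod.fst L ⊓ 𝓟 Bad := Ultrafilter.of_le _
  have hbad : ∀ᶠ x in 𝒰, x ∈ Bad := hle.trans inf_le_right (mem_principal_self _)
  have hfst : Tendsto (fun x : (ℝ × (Fin 2 → ℝ)) × (Fin 2 → ℂ) => x.1) 𝒰 L :=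
    tendsto_iff_comap.2 (hle.trans inf_le_left)
  have ht' : Tendsto (fun x : (ℝ × (Fin 2 → ℝ)) × (Fin 2 → ℂ) => x.1.1) 𝒰 (𝓝[>] 0) :=
    tendsto_fst.comp hfst
  have ht : Tendsto (fun x : (ℝ × (Fin 2 → ℝ)) × (Fin 2 → ℂ) => x.1.1) 𝒰 (𝓝 0) :=
    ht'.mono_right nhdsWithin_le_nhds
  have htpos : ∀ᶠ x : (ℝ × (Fin 2 → ℝ)) × (Fin 2 → ℂ) in 𝒰, 0 < x.1.1 :=
    ht'.eventually self_mem_nhdsWithin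
  have hr : Tendsto (fun x : (ℝ × (Fin 2 → ℝ)) × (Fin 2 → ℂ) => x.1.2) 𝒰 (𝓝 p) :=
    tendsto_snd.comp hfst
  have hP : ∀ᶠ x : (ℝ × (Fin 2 → ℝ)) × (Fin 2 → ℂ) in 𝒰, aeval x.2 f = (x.1.1 : ℂ) ^ 3 := hbad.mono fun x hx => hx.1
  have hκ : ∀ᶠ x : (ℝ × (Fin 2 → ℝ)) × (Fin 2 → ℂ) in 𝒰, curvatureForm f x.2 ≠ 0 := hbad.mono fun x hx => hx.2.1
  -- The bound `t ^ 2` enters only through its being `o(t)`, as required by `center_mem`.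
  have hdiv : ∀ m, Tendsto (fun x : (ℝ × (Fin 2 → ℝ)) × (Fin 2 → ℂ) =>
      (curvatureCenter f x.2 m - x.1.2 m) / x.1.1) 𝒰 (𝓝 0) := by
    intro m
    refine squeeze_zero_norm' ?_ ht
    filter_upwards [hbad, htpos] with x hx htx
    rw [norm_div, Complex.norm_real, Real.norm_of_nonneg htx.le, div_le_iff₀ htx]
    exact (hx.2.2.1 m).trans_eq (by ring)
  have hc : Tendsto (fun x : (ℝ × (Fin 2 → ℝ)) × (Fin 2 → ℂ) => curvatureCenter f x.2) 𝒰
      (𝓝 (toComplex p)) := by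
    rw [tendsto_pi_nhds]
    intro m
    have h1 : Tendsto (fun x : (ℝ × (Fin 2 → ℝ)) × (Fin 2 → ℂ) => ((x.1.2 m : ℝ) : ℂ)) 𝒰
        (𝓝 (toComplex p m)) :=
      (Complex.continuous_ofReal.tendsto _).comp (tendsto_pi_nhds.1 hr m)
    have h2 : Tendsto (fun x : (ℝ × (Fin 2 → ℝ)) × (Fin 2 → ℂ) => ((x.1.1 : ℝ) : ℂ)) 𝒰
        (𝓝 ((0 : ℝ) : ℂ)) := (Complex.continuous_ofReal.tendsto _).comp ht
    have h3 := h1.add ((hdiv m).mul h2)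
    rw [zero_mul, add_zero] at h3
    refine h3.congr' ?_
    filter_upwards [htpos] with x hx
    have : (x.1.1 : ℂ) ≠ 0 := by exact_mod_cast hx.ne'
    field_simp
    ring
  obtain ⟨R, hR⟩ := exists_norm_le_of_tendsto_center h.slope_injective ht hP hc
  obtain ⟨n, hn⟩ := exists_ultrafilter_tendsto 𝒰 _ R hR
  obtain ⟨r, s, hsr, hr0, hs0⟩ := exists_lineVal_eq_zero_of_tendsto ht hP hκ hn hc
  -- If `p` lies on the normal to line `r` at the limit node, general position identifies that
  -- normal with one of the two given ones, and its branch captures the centres, contradicting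
  -- badness.
  have main : ∀ r s, s ≠ r → lineVal (a r) (b r) n = 0 → lineVal (a s) (b s) n = 0 →
      normalForm (a r) (toComplex p - n) ≠ 0 := by
    intro r s hsr hr0 hs0 hnf
    have hnn := eq_node_of_lineVal (fun h' => hsr (h.slope_injective h').symm) hr0 hs0
    rw [hnn] at hnf hn
    have hmem : p 0 + a r * p 1 = normalConst (a r) (b r) (a s) (b s) := by
      rw [← node_mem_normal]
      simp only [normalForm, Pi.sub_apply, toComplex] at hnf
      have h5 : p 0 - node (a r) (b r) (a s) (b s) 0
          + a r * (p 1 - node (a r) (b r) (a s) (b s) 1) = 0 := by exact_mod_cast hnf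
      linear_combination h5
    have hcase : ∀ᶠ x : (ℝ × (Fin 2 → ℝ)) × (Fin 2 → ℂ) in 𝒰, ∃ m, curvatureCenter f x.2 0 =
        φ m (curvatureCenter f x.2 1, x.1.1) := by
      have htne := htpos.mono fun x hx => hx.ne'
      rcases h.eq_of_mem_normal hik hji hjk hli hlk hp₁ hp₂ hsr hmem with ⟨rfl, rfl⟩ | ⟨rfl, rfl⟩
      · exact (hφ₀.center_mem 𝒰 _ _ (fun x => x.1.2) ht htne hP hκ hn hc hdiv).mono
          fun x hx => ⟨0, hx⟩
      · exact (hφ₁.center_mem 𝒰 _ _ (fun x => x.1.2) ht htne hP hκ hn hc hdiv).mono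
          fun x hx => ⟨1, hx⟩
    obtain ⟨x, hx1, hx2⟩ := (hcase.and hbad).exists
    exact hx2.2.2.2 hx1
  have hrs : a r ≠ a s := fun h' => hsr (h.slope_injective h').symm
  have hnn := eq_node_of_lineVal hrs hr0 hs0
  have hG := h.aeval_otherLines_ne_zero hsr
  rw [← hnn] at hG
  have hfac : f = _ := lineArrangement_eq_mul_mul a b hsr
  have hpn : toComplex p ≠ n := by
    intro he
    apply h.ne_node hik hji hjk hli hlk hp₁ hp₂ hsr
    rw [hnn] at he
    ext m
    exact Complex.ofReal_injective (congrFun he m)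
  rcases normalForm_eq_zero_of_tendsto
    (l := (𝒰 : Filter ((ℝ × (Fin 2 → ℝ)) × (Fin 2 → ℂ)))) hrs hr0 hs0 hG
    (q := fun x => x.2) (c := fun x => curvatureCenter f x.2) (fun x => by rw [hfac]) (by rwa [← hfac]) hn hc hpn
    with h1 | h1
  · exact main r s hsr hr0 hs0 h1
  · exact main s r hsr.symm hs0 hr0 h1

/-- Each common point of two normals gives rise to a crunode of the evolute of a smoothing. -/
lemma GeneralPosition.eventually_exists_isCrunode (h : GeneralPosition a b) (hik : i ≠ k)
    (hji : j ≠ i) (hjk : j ≠ k) (hli : l ≠ i) (hlk : l ≠ k)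
    (hp₁ : p 0 + a i * p 1 = normalConst (a i) (b i) (a j) (b j))
    (hp₂ : p 0 + a k * p 1 = normalConst (a k) (b k) (a l) (b l)) {V : Set (Fin 2 → ℝ)}
    (hV : V ∈ 𝓝 p) :
    ∀ᶠ t in 𝓝[>] (0 : ℝ), ∃ p' ∈ V, IsCrunode (evolute (smoothing a b t)) p' := by
  obtain ⟨φ₀, hφ₀⟩ := h.exists_isNormalBranch hji hp₁
    (h.ne_node hik hji hjk hli hlk hp₁ hp₂ hji)
  obtain ⟨φ₁, hφ₁⟩ := h.exists_isNormalBranch hlk hp₂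
    (h.ne_node hik hji hjk hli hlk hp₁ hp₂ hlk)
  have hkey := h.eventually_center_mem hik hji hjk hli hlk hp₁ hp₂ (φ := ![φ₀, φ₁]) hφ₀ hφ₁
  set f := lineArrangement a b with hf
  set φ : Fin 2 → ℂ × ℂ → ℂ := ![φ₀, φ₁] with hφdef
  set σ : Fin 2 → ℝ := ![a i, a k] with hσ
  set ν : Fin 2 → Fin 2 → ℝ := ![node (a i) (b i) (a j) (b j), node (a k) (b k) (a l) (b l)]
  have hφ : ∀ m, IsNormalBranch f (σ m) (ν m) p (φ m) := by
    intro m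
    fin_cases m
    · exact hφ₀
    · exact hφ₁
  obtain ⟨pa, hpa, pb, hpb, hpab⟩ := eventually_prod_iff.1 hkey
  have hcast : Tendsto (fun y : ℝ × ℝ => ((y.1 : ℂ), (y.2 : ℂ))) (𝓝 (p 1, 0))
      (𝓝 ((p 1 : ℂ), (0 : ℂ))) :=
    Continuous.tendsto' (by fun_prop) _ _ (by simp)
  have g1 : ∀ᶠ y : ℝ × ℝ in 𝓝 (p 1, 0), ∀ m, AnalyticAt ℂ (φ m) ((y.1 : ℂ), (y.2 : ℂ)) :=
    eventually_all.2 fun m => hcast.eventually (hφ m).analyticAt.eventually_analyticAt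
  have g2 : ∀ᶠ y : ℝ × ℝ in 𝓝 (p 1, 0), ∀ m, ∀ᶠ x : ℝ × ℝ in 𝓝 y, (φ m (x.1, x.2)).im = 0 :=
    eventually_all.2 fun m => (hφ m).real.eventually_nhds
  have g3 : ∀ᶠ y : ℝ × ℝ in 𝓝 (p 1, 0), ∀ m, ∀ᶠ x : ℂ × ℂ in 𝓝 ((y.1 : ℂ), (y.2 : ℂ)),
      x.2 ≠ 0 → ∃ q : Fin 2 → ℂ, aeval q f = x.2 ^ 3 ∧ curvatureForm f q ≠ 0 ∧
        curvatureCenter f q = ![φ m x, x.1] :=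
    eventually_all.2 fun m => hcast.eventually (hφ m).exists_center.eventually_nhds
  have hslope : ∀ m, fderiv ℂ (φ m) ((p 1 : ℂ), (0 : ℂ)) (1, 0) = -(σ m : ℂ) := by
    intro m
    have h1 := hasDerivAt_slice (hφ m).analyticAt
    have h2 : HasDerivAt (fun y : ℂ => (p 0 : ℂ) - σ m * (y - p 1)) (-(σ m : ℂ)) (p 1 : ℂ) := by
      simpa using (((hasDerivAt_id (p 1 : ℂ)).sub_const (p 1 : ℂ)).const_mul
        (σ m : ℂ)).const_sub (p 0 : ℂ)
    exact h1.unique (h2.congr_of_eventuallyEq (hφ m).eq_line)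
  have g4 : ∀ᶠ y : ℝ × ℝ in 𝓝 (p 1, 0), fderiv ℂ (φ 0) ((y.1 : ℂ), (y.2 : ℂ)) (1, 0) ≠
      fderiv ℂ (φ 1) ((y.1 : ℂ), (y.2 : ℂ)) (1, 0) := by
    have hc : ∀ m, Tendsto (fun y : ℝ × ℝ => fderiv ℂ (φ m) ((y.1 : ℂ), (y.2 : ℂ)) (1, 0))
        (𝓝 (p 1, 0)) (𝓝 (-(σ m : ℂ))) := by
      intro m
      rw [← hslope m]
      have h1 := (hφ m).analyticAt.fderiv.continuousAt
      exact ((ContinuousLinearMap.apply ℂ ℂ ((1 : ℂ), (0 : ℂ))).continuous.tendsto _).comp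
        (Tendsto.comp h1 hcast)
    refine (((hc 0).sub (hc 1)).eventually_ne (sub_ne_zero.2 ?_)).mono fun y => sub_ne_zero.1
    simp only [ne_eq, neg_inj, Complex.ofReal_inj, hσ, Matrix.cons_val_zero, Matrix.cons_val_one]
    exact fun he => hik (h.slope_injective he)
  have hp0 : ∀ m, φ m ((p 1 : ℂ), 0) = p 0 := by
    intro m
    rw [(hφ m).eq_line.self_of_nhds]
    ring
  have hcr : Tendsto (fun y : ℝ × ℝ => ![(φ 0 ((y.1 : ℂ), (y.2 : ℂ))).re, y.1]) (𝓝 (p 1, 0))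
      (𝓝 p) := by
    rw [tendsto_pi_nhds]
    intro m
    fin_cases m
    · have h1 := (hφ 0).analyticAt.continuousAt
      have h2 := (Complex.continuous_re.tendsto _).comp (Tendsto.comp h1 hcast)
      rw [hp0, Complex.ofReal_re] at h2
      exact h2
    · exact continuous_fst.tendsto _
  have g5 : ∀ᶠ y : ℝ × ℝ in 𝓝 (p 1, 0), pb ![(φ 0 ((y.1 : ℂ), (y.2 : ℂ))).re, y.1] ∧
      ![(φ 0 ((y.1 : ℂ), (y.2 : ℂ))).re, y.1] ∈ V :=
    hcr.eventually (hpb.and hV)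
  -- the crossing of the two branches
  have hcross := eventually_exists_zero
    (ψ := fun y : ℝ × ℝ => (φ 0 ((y.1 : ℂ), (y.2 : ℂ))).re - (φ 1 ((y.1 : ℂ), (y.2 : ℂ))).re)
    (y₀ := p 1) (m := σ 1 - σ 0)
    (by
      simp only [hσ, Matrix.cons_val_zero, Matrix.cons_val_one]
      exact sub_ne_zero.2 fun he => hik (h.slope_injective he).symm)
    (by
      filter_upwards [g1] with y hy
      have hcy : ContinuousAt (fun y : ℝ × ℝ => ((y.1 : ℂ), (y.2 : ℂ))) y := by fun_prop
      exact (Complex.continuous_re.continuousAt.comp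
          (ContinuousAt.comp' (g := φ 0) (f := fun y : ℝ × ℝ => ((y.1 : ℂ), (y.2 : ℂ)))
            (hy 0).continuousAt hcy)).sub
        (Complex.continuous_re.continuousAt.comp
          (ContinuousAt.comp' (g := φ 1) (f := fun y : ℝ × ℝ => ((y.1 : ℂ), (y.2 : ℂ)))
            (hy 1).continuousAt hcy)))
    (by
      have hc : Tendsto (fun y : ℝ => (y : ℂ)) (𝓝 (p 1)) (𝓝 (p 1 : ℂ)) :=
        Complex.continuous_ofReal.tendsto _
      filter_upwards [hc.eventually (hφ 0).eq_line, hc.eventually (hφ 1).eq_line] with y h0 h1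
      simp only [Complex.ofReal_zero]
      rw [h0, h1, ← Complex.sub_re]
      rw [← Complex.ofReal_re ((σ 1 - σ 0) * (y - p 1))]
      congr 1
      push_cast
      ring)
    (((g1.and g2).and (g3.and g4)).and g5)
  filter_upwards [hpa, hcross.filter_mono nhdsWithin_le_nhds, self_mem_nhdsWithin]
    with t hta ⟨y, ⟨⟨⟨k1, k2⟩, ⟨k3, k4⟩⟩, ⟨k5, k6⟩⟩, hzero⟩ htpos
  have htne : (t : ℂ) ≠ 0 := by exact_mod_cast (ne_of_gt htpos)
  set p' : Fin 2 → ℝ := ![(φ 0 ((y : ℂ), (t : ℂ))).re, y] with hp'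
  -- The crossing was found for real parts only; both values are real, so they coincide.
  have hval : ∀ m, φ m ((y : ℂ), (t : ℂ)) = p' 0 := by
    have him : ∀ m, (φ m ((y : ℂ), (t : ℂ))).im = 0 := fun m => (k2 m).self_of_nhds
    intro m
    fin_cases m
    · exact Complex.ext (by simp [hp']) (by simpa using him 0)
    · exact Complex.ext (by simp [hp']; linarith) (by simpa using him 1)
  have hB := hpab hta k5
  simp only at hB
  refine ⟨p', k6, isCrunode_of_graphs (ψ := fun m y => φ m (y, (t : ℂ))) ?_ ?_ hval ?_ ?_⟩
  · intro m
    exact AnalyticAt.fun_comp (g := φ m) (f := fun y : ℂ => (y, (t : ℂ))) (k1 m)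
      (analyticAt_id.prod analyticAt_const)
  · intro m
    have hc : Tendsto (fun y : ℝ => (y, t)) (𝓝 y) (𝓝 (y, t)) :=
      Continuous.tendsto' (by fun_prop) _ _ rfl
    exact hc.eventually (k2 m)
  · have e := fun m => (hasDerivAt_slice (k1 m)).deriv
    change deriv (fun y => φ 0 (y, (t : ℂ))) (y : ℂ) ≠ deriv (fun y => φ 1 (y, (t : ℂ))) (y : ℂ)
    rw [e, e]
    exact k4
  · have hc : Tendsto (fun z : Fin 2 → ℂ => (z 1, (t : ℂ))) (𝓝 (toComplex p'))
        (𝓝 ((y : ℂ), (t : ℂ))) :=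
      Continuous.tendsto' (by fun_prop) _ _ (by simp [toComplex, hp'])
    -- For this fixed `t` the `t ^ 2`-ball around `p'` is a genuine neighbourhood, and only the two
    -- real branches meet it.
    have hclose : ∀ᶠ z in 𝓝 (toComplex p'), ∀ m : Fin 2,
        ‖z m - (p' m : ℂ)‖ < t ^ 2 := by
      refine eventually_all.2 fun m => ?_
      have h1 : Tendsto (fun z : Fin 2 → ℂ => ‖z m - (p' m : ℂ)‖) (𝓝 (toComplex p')) (𝓝 0) :=
        Continuous.tendsto' (by fun_prop) _ _ (by simp [toComplex])
      exact h1.eventually_lt_const (pow_pos htpos 2)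
    have e1 : ∀ᶠ z in 𝓝 (toComplex p'), ∀ m, AnalyticAt ℂ (φ m) (z 1, (t : ℂ)) :=
      eventually_all.2 fun m => hc.eventually (k1 m).eventually_analyticAt
    have e3 := hc.eventually (eventually_all.2 k3)
    filter_upwards [hclose.eventually_nhds, e1, e3] with z h1 h2 h3
    have hcont : ∀ m, ContinuousAt (fun z : Fin 2 → ℂ => z 0 - φ m (z 1, (t : ℂ))) z := by
      intro m
      have hz : ContinuousAt (fun z : Fin 2 → ℂ => (z 1, (t : ℂ))) z :=
        ((continuous_apply 1).prodMk continuous_const).continuousAt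
      exact (continuous_apply 0).continuousAt.sub
        (ContinuousAt.comp' (g := φ m) (f := fun z : Fin 2 → ℂ => (z 1, (t : ℂ))) (h2 m).continuousAt hz)
    constructor
    · intro hz
      have hz' := hz
      rw [evolute, mem_closure_iff_frequently] at hz'
      -- The evolute is a closure, so `z` is only a limit of centres. The union of the two graphs is
      -- the zero set of this continuous product, so the relation passes to the limit.
      have hfr : ∃ᶠ x in 𝓝 z, (x 0 - φ 0 (x 1, (t : ℂ))) * (x 0 - φ 1 (x 1, (t : ℂ))) = 0 := by
        refine (hz'.and_eventually h1).mono ?_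
        rintro x ⟨⟨q, hq, hqκ, rfl⟩, hx⟩
        rw [smoothing, curvatureForm_sub_C] at hqκ
        rw [smoothing, curvatureCenter_sub_C] at hx ⊢
        have hq' : aeval q f = (t : ℂ) ^ 3 := by
          rw [smoothing, map_sub, sub_eq_zero] at hq
          rw [hf, hq]
          simp
        obtain ⟨m, hm⟩ := hB q hq' hqκ fun m => (hx m).le
        fin_cases m
        · exact mul_eq_zero.2 (Or.inl (sub_eq_zero.2 hm))
        · exact mul_eq_zero.2 (Or.inr (sub_eq_zero.2 hm))
      have hmul : (z 0 - φ 0 (z 1, (t : ℂ))) * (z 0 - φ 1 (z 1, (t : ℂ))) = 0 := by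
        by_contra hne
        exact hfr (((hcont 0).mul (hcont 1)).eventually_ne hne)
      rcases mul_eq_zero.1 hmul with h4 | h4
      · exact Or.inl (sub_eq_zero.1 h4)
      · exact Or.inr (sub_eq_zero.1 h4)
    · intro hz
      obtain ⟨m, hm⟩ : ∃ m, z 0 = φ m (z 1, (t : ℂ)) := hz.elim (fun h => ⟨0, h⟩) fun h => ⟨1, h⟩
      obtain ⟨q, q1, q2, q3⟩ := h3 m htne
      refine subset_closure ⟨q, ?_, ?_, ?_⟩
      · rw [smoothing, map_sub, ← hf, q1]
        simp
      · rwa [smoothing, curvatureForm_sub_C]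
      · rw [smoothing, curvatureCenter_sub_C, ← hf, q3]
        ext m
        fin_cases m
        · exact hm
        · rfl

end Crossing

/-! ### Counting the crossings -/

/-- The index set for the crossings of normals: the `j`-th line meets the `i`-th one, the `l`-th
line meets the `k`-th one, and the normals in question are those to the `i`-th and the `k`-th. -/
def crossingIndices (d : ℕ) : Finset ((Σ _ : Fin d, Fin d) × (Fin d × Fin d)) :=
  ((Finset.univ.sigma fun k : Fin d => Finset.Iio k).sigma fun x =>
    ((Finset.univ.erase x.1).erase x.2) ×ˢ ((Finset.univ.erase x.1).erase x.2)).map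
      (Equiv.sigmaEquivProd _ _).toEmbedding

lemma mem_crossingIndices {d : ℕ} {k i j l : Fin d} :
    (⟨k, i⟩, (j, l)) ∈ crossingIndices d ↔ i < k ∧ (j ≠ i ∧ j ≠ k) ∧ l ≠ i ∧ l ≠ k := by
  simp [crossingIndices]

lemma card_crossingIndices (d : ℕ) :
    (crossingIndices d).card = (∑ k ∈ Finset.range d, k) * (d - 2) ^ 2 := by
  have h : ∀ x ∈ Finset.univ.sigma fun k : Fin d => Finset.Iio k,
      (((Finset.univ.erase x.1).erase x.2) ×ˢ ((Finset.univ.erase x.1).erase x.2)).card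
        = (d - 2) ^ 2 := by
    rintro ⟨k, i⟩ hx
    simp only [Finset.mem_sigma, Finset.mem_univ, Finset.mem_Iio, true_and] at hx
    rw [Finset.card_product, Finset.card_erase_of_mem (by simp [hx.ne]),
      Finset.card_erase_of_mem (Finset.mem_univ _), Finset.card_univ, Fintype.card_fin, sq]
    rfl
  rw [crossingIndices, Finset.card_map, Finset.card_sigma, Finset.sum_congr rfl h,
    Finset.sum_const, Finset.card_sigma, smul_eq_mul]
  simp only [Fin.card_Iio]
  rw [Fin.sum_univ_eq_sum_range fun k => k]

/-- With `e = d - 2` one has `2 * m ≤ e * (e + 2)`, while the number of crossings is `(e + 2) * (e +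
1) / 2 * e ^ 2`. The crude bound `2 * m.choose 2 ≤ m ^ 2` and `e + 2 ≤ 4 * (e + 1)` are enough. -/
lemma choose_two_le_card_crossingIndices {d : ℕ} (hd : 2 ≤ d) :
    ((d - 2) ^ 2 / 2 + (d - 2)).choose 2 ≤ (crossingIndices d).card := by
  obtain ⟨e, rfl⟩ : ∃ e, d = e + 2 := ⟨d - 2, by omega⟩
  rw [card_crossingIndices]
  have hS := Finset.sum_range_id_mul_two (e + 2)
  simp only [Nat.add_sub_cancel] at hS ⊢
  set S := ∑ k ∈ Finset.range (e + 2), k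
  set m := e ^ 2 / 2 + e with hm
  have h1 : 2 * m ≤ e * (e + 2) := by
    have := Nat.div_mul_le_self (e ^ 2) 2
    nlinarith
  have h2 : 2 * m.choose 2 ≤ m * m := by
    rw [Nat.choose_two_right]
    have := Nat.div_mul_le_self (m * (m - 1)) 2
    have := Nat.mul_le_mul_left m (Nat.sub_le m 1)
    omega
  have h3 : (2 * m) * (2 * m) ≤ (e * (e + 2)) * (e * (e + 2)) := Nat.mul_le_mul h1 h1
  have h4 : (e * (e + 2)) * (e * (e + 2)) ≤ 4 * (S * 2) * e ^ 2 := by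
    rw [hS, show (e + 2 - 1) = e + 1 by omega]
    have : e + 2 ≤ 4 * (e + 1) := by omega
    calc (e * (e + 2)) * (e * (e + 2)) = (e ^ 2 * (e + 2)) * (e + 2) := by ring
      _ ≤ (e ^ 2 * (e + 2)) * (4 * (e + 1)) := Nat.mul_le_mul_left _ this
      _ = 4 * ((e + 2) * (e + 1)) * e ^ 2 := by ring
  have h5 : 4 * (S * 2) * e ^ 2 = 8 * (S * e ^ 2) := by ring
  have h6 : (2 * m) * (2 * m) = 4 * (m * m) := by ring
  omega

variable {d : ℕ} {a b : Fin d → ℝ}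

/-- The common point of the two normals with the given indices. -/
noncomputable def crossing (a b : Fin d → ℝ) (x : (Σ _ : Fin d, Fin d) × (Fin d × Fin d)) :
    Fin 2 → ℝ :=
  normalsMeet (a x.1.2) (normalConst (a x.1.2) (b x.1.2) (a x.2.1) (b x.2.1))
    (a x.1.1) (normalConst (a x.1.1) (b x.1.1) (a x.2.2) (b x.2.2))

/-- A crossing lies on exactly two normals, so it determines the pairs `(i, j)` and `(k, l)` up to
order, and `i < k` fixes the order. -/
lemma GeneralPosition.injOn_crossing (h : GeneralPosition a b) :
    Set.InjOn (crossing a b) (crossingIndices d) := by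
  rintro ⟨⟨k, i⟩, j, l⟩ hx ⟨⟨k', i'⟩, j', l'⟩ hx' he
  obtain ⟨hik, ⟨hji, hjk⟩, hli, hlk⟩ := mem_crossingIndices.1 hx
  obtain ⟨hik', ⟨hji', hjk'⟩, hli', hlk'⟩ := mem_crossingIndices.1 hx'
  have e1 := normalsMeet_left (a i) (normalConst (a i) (b i) (a j) (b j)) (a k)
    (normalConst (a k) (b k) (a l) (b l))
  have e2 := normalsMeet_right (normalConst (a i) (b i) (a j) (b j))
    (normalConst (a k) (b k) (a l) (b l)) (fun h' => hik.ne (h.slope_injective h'))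
  have e1' := normalsMeet_left (a i') (normalConst (a i') (b i') (a j') (b j')) (a k')
    (normalConst (a k') (b k') (a l') (b l'))
  have e2' := normalsMeet_right (normalConst (a i') (b i') (a j') (b j'))
    (normalConst (a k') (b k') (a l') (b l')) (fun h' => hik'.ne (h.slope_injective h'))
  simp only [crossing] at he
  rw [← he] at e1' e2'
  have k1 := h.eq_of_mem_normal hik.ne hji hjk hli hlk e1 e2 hji' e1'
  have k2 := h.eq_of_mem_normal hik.ne hji hjk hli hlk e1 e2 hlk' e2'
  rcases k1 with ⟨rfl, rfl⟩ | ⟨rfl, rfl⟩ <;> rcases k2 with ⟨rfl, rfl⟩ | ⟨rfl, rfl⟩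
  · exact absurd hik' (lt_irrefl _)
  · rfl
  · exact absurd hik' (lt_asymm hik)
  · exact absurd hik' (lt_irrefl _)

/-- For small `t` the evolute of the smoothing has a crunode for every crossing of normals. -/
lemma GeneralPosition.eventually_card_le_evoluteCrunodes (h : GeneralPosition a b) :
    ∀ᶠ t in 𝓝[>] (0 : ℝ), ((crossingIndices d).card : ℕ∞) ≤ evoluteCrunodes (smoothing a b t) := by
  -- Disjoint neighbourhoods of the finitely many crossings keep the resulting crunodes distinct.
  obtain ⟨U, hU, hdisj⟩ := ((crossingIndices d).finite_toSet.image (crossing a b)).t2_separation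
  have hev : ∀ x ∈ crossingIndices d, ∀ᶠ t in 𝓝[>] (0 : ℝ),
      ∃ p' ∈ U (crossing a b x), IsCrunode (evolute (smoothing a b t)) p' := by
    rintro ⟨⟨k, i⟩, j, l⟩ hx
    obtain ⟨hik, ⟨hji, hjk⟩, hli, hlk⟩ := mem_crossingIndices.1 hx
    exact h.eventually_exists_isCrunode hik.ne hji hjk hli hlk (normalsMeet_left _ _ _ _)
      (normalsMeet_right _ _ fun h' => hik.ne (h.slope_injective h'))
      ((hU _).2.mem_nhds (hU _).1)
  filter_upwards [(Finset.eventually_all _).2 hev] with t ht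
  choose! g hgU hg using ht
  have hinj : Set.InjOn g (crossingIndices d) := by
    intro x hx y hy hxy
    by_contra hne
    have hne' : crossing a b x ≠ crossing a b y := fun he => hne (h.injOn_crossing hx hy he)
    have := hdisj (Set.mem_image_of_mem _ hx) (Set.mem_image_of_mem _ hy) hne'
    exact Set.disjoint_left.1 this (hgU x hx) (hxy ▸ hgU y hy)
  rw [← Set.encard_coe_eq_coe_finsetCard, ← hinj.encard_image, evoluteCrunodes]
  refine Set.encard_le_encard ?_
  rintro _ ⟨x, hx, rfl⟩
  exact hg x hx

end PlaneEvolute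

theorem mainTheorem6 (d : ℕ) (hd : 2 ≤ d) :
    ((((d - 2) ^ 2 / 2 + (d - 2)).choose 2 : ℕ) : ℕ∞) ≤ PlaneEvolute.maxEvoluteCrunodes d := by
  obtain ⟨a, b, h⟩ := PlaneEvolute.exists_generalPosition d
  obtain ⟨t, h1, h2⟩ := (h.eventually_card_le_evoluteCrunodes.and
    (PlaneEvolute.isRealCurve_smoothing (by omega) a b)).exists
  refine le_trans (Nat.cast_le.2 (PlaneEvolute.choose_two_le_card_crossingIndices hd)) (h1.trans ?_)
  exact le_iSup (fun f : {f : MvPolynomial (Fin 2) ℝ // PlaneEvolute.IsRealCurve d f} =>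
    PlaneEvolute.evoluteCrunodes f.1) ⟨PlaneEvolute.smoothing a b t, h2⟩
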